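/- Let $q$ be a real-valued $C^\infty$ function defined on a neighborhood of $[0,1]$, let $\lambda_1<\lambda_2<\cdots$ be all the eigenvalues of the Dirichlet problem $-y''+qy=\lambda y$ in $(0,1)$, $y(0)=y(1)=0$, and let $h_1,h_2,\dots$ be associated real eigenfunctions, orthonormal in $L^2(0,1)$. For $k\ge 1$ put $\Omega_k=\{x\in\mathbb{R}^k : 0<x_1<\cdots<x_k<1\}$ and $\mathfrak{S}_k(x_1,\dots,x_k)=\det\big(h_i(x_j)\big)_{1\le i,j\le k}$. Let $n\ge 1$ and $Q(x_1,\dots,x_n)=q(x_1)+\cdots+q(x_n)$. Then: 1. $\mathfrak{S}_n$ is the first eigenfunction of the Dirichlet realization of $-\Delta+Q$ in $\Omega_n$, with eigenvalue $\Lambda=\lambda_1+\cdots+\lambda_n$. That is: $\mathfrak{S}_n$ is a nonzero element of $H^1_0(\Omega_n)$ satisfying $-\Delta \mathfrak{S}_n+Q\,\mathfrak{S}_n=\Lambda\,\mathfrak{S}_n$ weakly in $\Omega_n$; every eigenvalue of $-\Delta+Q$ in $\Omega_n$ with an eigenfunction in $H^1_0(\Omega_n)$ is at least $\Lambda$; and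 every eigenfunction in $H^1_0(\Omega_n)$ for $\Lambda$ is a constant multiple of $\mathfrak{S}_n$. 2. $\mathfrak{S}_n$ does not vanish in $\Omega_n$. 3. The signs of $h_1,\dots,h_n$ can be chosen such that $\mathfrak{S}_k>0$ in $\Omega_k$ for all $1\le k\le n$ simultaneously. 4. For all $c_1<\cdots<c_n$ in $(0,1)$, the vectors $\vec h(c_1),\dots,\vec h(c_n)$ are linearly independent in $\mathbb{R}^n$, where $\vec h(c)=(h_1(c),\dots,h_n(c))$. -/

import Mathlib

open MeasureTheory Set Filter Topology
open scoped ContDiff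

namespace SturmGelfand

noncomputable section

/-! ### The one-particle problem on the interval `(0,1)` -/

/-- `y` is an eigenfunction, with eigenvalue `μ`, of the Dirichlet problem
`-y'' + q y = μ y` in `(0,1)`, `y 0 = y 1 = 0`. Only the values of `y` on `[0,1]` matter. -/
structure IsSturmEigenfunction (q : ℝ → ℝ) (μ : ℝ) (y : ℝ → ℝ) : Prop where
  contDiffOn : ContDiffOn ℝ 2 y (Icc 0 1)
  left : y 0 = 0
  right : y 1 = 0
  ode : ∀ x ∈ Ioo (0 : ℝ) 1, -deriv (deriv y) x + q x * y x = μ * y x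
  nontrivial : ∃ x ∈ Ioo (0 : ℝ) 1, y x ≠ 0

/-- `(lam j, h j)`, `j = 0, 1, 2, …`, are the eigenpairs of the Dirichlet problem for
`-d²/dx² + q` in `(0,1)`: the sequence `lam` lists all the eigenvalues in increasing order and
the `h j` are associated eigenfunctions, orthonormal in `L²(0,1)`.
(Indices start at `0`: `lam j` and `h j` are the `(j+1)`-st eigenvalue and eigenfunction.) -/
structure IsSturmEigenpairs (q : ℝ → ℝ) (lam : ℕ → ℝ) (h : ℕ → ℝ → ℝ) : Prop where
  strictMono : StrictMono lam
  eigen : ∀ j, IsSturmEigenfunction q (lam j) (h j)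
  exhaust : ∀ (μ : ℝ) (y : ℝ → ℝ), IsSturmEigenfunction q μ y → ∃ j, lam j = μ
  orthonormal : ∀ i j, ∫ x in (0 : ℝ)..1, h i x * h j x = if i = j then 1 else 0

/-! ### Dirichlet realizations of Schrödinger operators on open sets of `ℝⁿ` -/

/-- Test functions: `φ ∈ C_c^∞(Ω)`. -/
def IsTestFunction {n : ℕ} (Ω : Set (Fin n → ℝ)) (φ : (Fin n → ℝ) → ℝ) : Prop :=
  ContDiff ℝ ∞ φ ∧ HasCompactSupport φ ∧ tsupport φ ⊆ Ω

/-- The partial derivative `∂φ/∂x_i`. -/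
def partialDeriv {n : ℕ} (i : Fin n) (φ : (Fin n → ℝ) → ℝ) (x : Fin n → ℝ) : ℝ :=
  fderiv ℝ φ x (Pi.single i 1)

/-- `u` belongs to `H_0^1(Ω)`, the closure of `C_c^∞(Ω)` in the norm
`(‖u‖² + ∑ i, ‖∂_i u‖²)^(1/2)` (norms of `L²(Ω)`), and `g` is its weak gradient. -/
def HasH01Gradient {n : ℕ} (Ω : Set (Fin n → ℝ)) (u : (Fin n → ℝ) → ℝ)
    (g : Fin n → (Fin n → ℝ) → ℝ) : Prop :=
  MemLp u 2 (volume.restrict Ω) ∧ (∀ i, MemLp (g i) 2 (volume.restrict Ω)) ∧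
    ∃ φ : ℕ → (Fin n → ℝ) → ℝ, (∀ k, IsTestFunction Ω (φ k)) ∧
      Tendsto (fun k => eLpNorm (fun x => φ k x - u x) 2 (volume.restrict Ω)) atTop (𝓝 0) ∧
      ∀ i, Tendsto (fun k => eLpNorm (fun x => partialDeriv i (φ k) x - g i x) 2
        (volume.restrict Ω)) atTop (𝓝 0)

/-- `u` is an eigenfunction, with eigenvalue `μ`, of the Dirichlet realization of `-Δ + V` in `Ω`:
`u` is a nonzero element of `H_0^1(Ω)` and `-Δu + V u = μ u` holds weakly in `Ω`. -/
def IsDirichletEigenfunction {n : ℕ} (Ω : Set (Fin n → ℝ)) (V : (Fin n → ℝ) → ℝ) (μ : ℝ)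
    (u : (Fin n → ℝ) → ℝ) : Prop :=
  (¬ u =ᵐ[volume.restrict Ω] 0) ∧
    ∃ g : Fin n → (Fin n → ℝ) → ℝ, HasH01Gradient Ω u g ∧
      ∀ φ : (Fin n → ℝ) → ℝ, IsTestFunction Ω φ →
        ∫ x in Ω, ((∑ i, g i x * partialDeriv i φ x) + V x * u x * φ x) =
          μ * ∫ x in Ω, u x * φ x

/-- `u` is the first eigenfunction of the Dirichlet realization of `-Δ + V` in `Ω`, with
eigenvalue `μ`: `μ` is the least eigenvalue, `u` is an eigenfunction for `μ`, and `u` is unique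
up to a multiplicative constant. -/
def IsFirstDirichletEigenfunction {n : ℕ} (Ω : Set (Fin n → ℝ)) (V : (Fin n → ℝ) → ℝ) (μ : ℝ)
    (u : (Fin n → ℝ) → ℝ) : Prop :=
  IsDirichletEigenfunction Ω V μ u ∧
    (∀ (ν : ℝ) (v : (Fin n → ℝ) → ℝ), IsDirichletEigenfunction Ω V ν v → μ ≤ ν) ∧
    ∀ v : (Fin n → ℝ) → ℝ, IsDirichletEigenfunction Ω V μ v →
      ∃ C : ℝ, v =ᵐ[volume.restrict Ω] fun x => C * u x

/-! ### The `n`-particle problem -/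

/-- The simplex `0 < x_1 < x_2 < ⋯ < x_n < 1`. -/
def simplex (n : ℕ) : Set (Fin n → ℝ) :=
  {x | (∀ j, x j ∈ Ioo (0 : ℝ) 1) ∧ StrictMono x}

/-- The potential `Q(x_1, …, x_n) = q(x_1) + ⋯ + q(x_n)`. -/
def potential (q : ℝ → ℝ) {n : ℕ} (x : Fin n → ℝ) : ℝ := ∑ j, q (x j)

/-- The Slater determinant `det (h_i(x_j))` of size `n`. -/
def slater (h : ℕ → ℝ → ℝ) (n : ℕ) (x : Fin n → ℝ) : ℝ :=
  Matrix.det (Matrix.of fun i j : Fin n => h i (x j))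

end

end SturmGelfand

/-! Everything rests on the fact that the Slater determinant has no zero in the open simplex. If it
vanished at `c`, a nontrivial combination of the first `n` eigenfunctions would vanish at the `n`
points `c j`, against Sturm's theorem: such a combination has at most `n - 1` zeros in `(0,1)`
(`zeros_sum_le`, `zeros_sum_lt`, `slater_ne_zero`).

Sturm's theorem has two sources. The bound for a single eigenfunction (`zeros_le`) uses the Prüfer
angle `θ`: if `h j` has `N` interior zeros, then `θ` at `1` is at least `(N + 1)π` for the parameter
`lam j`, and it is below `π / 2` for very negative parameters. By continuity it takes the values `π,
…, Nπ` in between, each at an eigenvalue below `lam j`, and there are only `j` of those. For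
combinations, the operator `-d²/dx² + q - lam 0` does not lose zeros, by Rolle's theorem applied to
the quotient by the ground state and then to a Wronskian. Iterated and normalised, it damps every
coefficient except the one of the highest mode. The `C¹` limit is a multiple of that mode, whose
zeros are simple, so the zeros of the combination survive in the limit.

The spectral statement is Jacobi's argument. The determinant `u` solves the equation classically,
since it is a sum of products of eigenfunctions, and it vanishes on the boundary. Writing a test
function as `u ψ` gives `∫ |∇(uψ)|² + Q (uψ)² = Λ ∫ (uψ)² + ∫ u² |∇ψ|²` (`energy_mul`). Hence no
eigenvalue lies below `Λ`, and an eigenfunction `v` for `Λ` makes the last term tend to zero, so `v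
/ u` has zero weak gradient and is constant on the convex simplex.

Constancy of sign follows from connectedness, the signs are normalised by a telescoping product, and
linear independence is the nonvanishing of the determinant. -/

namespace SturmGelfand

/-! ### Solutions of the one-dimensional equation -/

/-- `Y` is a `C²` function on the line which solves `-Y'' + q Y = μ Y` on `[0,1]`. -/
structure IsRegularSolution (q : ℝ → ℝ) (μ : ℝ) (Y : ℝ → ℝ) : Prop where
  contDiff : ContDiff ℝ 2 Y
  ode : ∀ x ∈ Icc (0 : ℝ) 1, deriv (deriv Y) x = (q x - μ) * Y x

namespace IsRegularSolution

variable {q : ℝ → ℝ} {μ : ℝ} {Y : ℝ → ℝ}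

theorem contDiff_deriv (hY : IsRegularSolution q μ Y) : ContDiff ℝ 1 (deriv Y) :=
  (contDiff_succ_iff_deriv (n := 1).1 (by simpa [one_add_one_eq_two] using hY.contDiff)).2.2

theorem hasDerivAt (hY : IsRegularSolution q μ Y) (x : ℝ) : HasDerivAt Y (deriv Y x) x :=
  (hY.contDiff.differentiable (by norm_num) x).hasDerivAt

theorem hasDerivAt_deriv' (hY : IsRegularSolution q μ Y) (x : ℝ) :
    HasDerivAt (deriv Y) (deriv (deriv Y) x) x :=
  (hY.contDiff_deriv.differentiable (by norm_num) x).hasDerivAt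

theorem hasDerivAt_deriv (hY : IsRegularSolution q μ Y) {x : ℝ} (hx : x ∈ Icc (0 : ℝ) 1) :
    HasDerivAt (deriv Y) ((q x - μ) * Y x) x := by
  rw [← hY.ode x hx]
  exact hY.hasDerivAt_deriv' x

/-- Bootstrap: `Y''` is `(q - μ) Y`, hence as regular as `Y` itself. Smoothness is what allows test
functions to be divided by the Slater determinant later. -/
theorem contDiffOn_infty (hY : IsRegularSolution q μ Y) (hq : ContDiffOn ℝ ∞ q (Ioo 0 1)) :
    ContDiffOn ℝ ∞ Y (Ioo 0 1) := by
  rw [_root_.contDiffOn_infty]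
  intro n
  induction n with
  | zero => exact (hY.contDiff.of_le (by norm_num)).contDiffOn
  | succ n ih =>
    have h2 : ContDiffOn ℝ n (deriv (deriv Y)) (Ioo 0 1) := by
      refine ContDiffOn.congr (f := fun x => (q x - μ) * Y x) ?_
        (fun x hx => hY.ode x (Ioo_subset_Icc_self hx))
      exact ((hq.of_le (by exact_mod_cast le_top)).sub contDiffOn_const).mul ih
    have h1 : ContDiffOn ℝ (n + 1) (deriv Y) (Ioo 0 1) := by
      rw [contDiffOn_succ_iff_deriv_of_isOpen isOpen_Ioo]
      exact ⟨hY.contDiff_deriv.differentiable (by norm_num) |>.differentiableOn,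
        fun h => by simp at h, h2⟩
    push_cast
    rw [contDiffOn_succ_iff_deriv_of_isOpen isOpen_Ioo]
    exact ⟨hY.contDiff.differentiable (by norm_num) |>.differentiableOn,
      fun h => by simp at h, h1.of_le (by norm_cast; omega)⟩

/-- A solution with a double zero vanishes identically. -/
theorem eq_zero_of_double_zero (hY : IsRegularSolution q μ Y) (hq : ContinuousOn q (Icc 0 1))
    {c : ℝ} (hc : c ∈ Icc (0 : ℝ) 1) (h0 : Y c = 0) (h1 : deriv Y c = 0) :
    ∀ x ∈ Icc (0 : ℝ) 1, Y x = 0 := by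
  obtain ⟨C, hC⟩ := isCompact_Icc.exists_bound_of_continuousOn
    (f := fun x => q x - μ + 1) (s := Icc (0:ℝ) 1)
    ((hq.sub continuousOn_const).add continuousOn_const)
  simp only [Real.norm_eq_abs] at hC
  -- Since `|E'| ≤ C E`, the function `E exp (C x)` increases and `E exp (-C x)` decreases; so `E c
  -- = 0` propagates to the left and to the right.
  set E : ℝ → ℝ := fun x => Y x ^ 2 + deriv Y x ^ 2 with hE
  have hEd : ∀ x ∈ Icc (0:ℝ) 1, HasDerivAt E (2 * (q x - μ + 1) * (Y x * deriv Y x)) x := by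
    intro x hx
    exact (((hY.hasDerivAt x).pow 2).add ((hY.hasDerivAt_deriv hx).pow 2)).congr_deriv
      (by push_cast; ring)
  have hEb : ∀ x ∈ Icc (0:ℝ) 1, |2 * (q x - μ + 1) * (Y x * deriv Y x)| ≤ C * E x := by
    intro x hx
    have h1 : |2 * (Y x * deriv Y x)| ≤ E x := by
      rw [abs_le]
      constructor <;> simp only [hE] <;>
        nlinarith [sq_nonneg (Y x + deriv Y x), sq_nonneg (Y x - deriv Y x)]
    have : 2 * (q x - μ + 1) * (Y x * deriv Y x) = (q x - μ + 1) * (2 * (Y x * deriv Y x)) := by ring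
    rw [this, abs_mul]
    exact mul_le_mul (hC x hx) h1 (abs_nonneg _) ((abs_nonneg _).trans (hC x hx))
  have hE0 : E c = 0 := by simp [hE, h0, h1]
  have hexp : ∀ s x : ℝ, HasDerivAt (fun x => Real.exp (s * x)) (Real.exp (s * x) * s) x := by
    intro s x
    simpa using ((hasDerivAt_id x).const_mul s).exp
  have key : ∀ x ∈ Icc (0:ℝ) 1, E x ≤ 0 := by
    intro x hx
    rcases le_total x c with hxc | hxc
    · have hm : MonotoneOn (fun x => E x * Real.exp (C * x)) (Icc 0 1) := by
        refine monotoneOn_of_hasDerivWithinAt_nonneg (convex_Icc 0 1)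
          (fun x hx => ((hEd x hx).mul (hexp C x)).continuousAt.continuousWithinAt)
          (fun x hx => ((hEd x (interior_subset hx)).mul (hexp C x)).hasDerivWithinAt) ?_
        intro x hx
        have := (abs_le.1 (hEb x (interior_subset hx))).1
        have h2 := Real.exp_pos (C * x)
        nlinarith
      have := hm hx hc hxc
      simp only [hE0, zero_mul] at this
      exact nonpos_of_mul_nonpos_left this (Real.exp_pos _)
    · have hm : AntitoneOn (fun x => E x * Real.exp (-C * x)) (Icc 0 1) := by
        refine antitoneOn_of_hasDerivWithinAt_nonpos (convex_Icc 0 1)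
          (fun x hx => ((hEd x hx).mul (hexp (-C) x)).continuousAt.continuousWithinAt)
          (fun x hx => ((hEd x (interior_subset hx)).mul (hexp (-C) x)).hasDerivWithinAt) ?_
        intro x hx
        have := (abs_le.1 (hEb x (interior_subset hx))).2
        have h2 := Real.exp_pos (-C * x)
        nlinarith
      have := hm hc hx hxc
      simp only [hE0, zero_mul] at this
      exact nonpos_of_mul_nonpos_left this (Real.exp_pos _)
  intro x hx
  have := key x hx
  simp only [hE] at this
  have h3 : Y x ^ 2 = 0 := by nlinarith [sq_nonneg (Y x), sq_nonneg (deriv Y x)]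
  simpa using h3

end IsRegularSolution

/-- An eigenfunction on `[0,1]` extends to a `C²` function on the line. -/
theorem IsSturmEigenfunction.exists_extension {q : ℝ → ℝ} {μ : ℝ} {y : ℝ → ℝ}
    (hy : IsSturmEigenfunction q μ y) (hq : ContinuousOn q (Icc 0 1)) :
    ∃ Y : ℝ → ℝ, IsRegularSolution q μ Y ∧ EqOn Y y (Icc 0 1) := by
  have hU : UniqueDiffOn ℝ (Icc (0:ℝ) 1) := uniqueDiffOn_Icc zero_lt_one
  set p := derivWithin y (Icc 0 1) with hp
  have hpc : ContinuousOn p (Icc 0 1) := hy.contDiffOn.continuousOn_derivWithin hU (by norm_num)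
  have hyc : ContinuousOn y (Icc 0 1) := hy.contDiffOn.continuousOn
  have hgc : ContinuousOn (fun x => (q x - μ) * y x) (Icc 0 1) :=
    (hq.sub continuousOn_const).mul hyc
  -- `F` continues `y''` beyond `[0,1]` by its boundary values. Integrating it twice, with the
  -- initial data of `y` at `0`, gives the extension.
  set F : ℝ → ℝ := fun x => (fun x => (q x - μ) * y x) (projIcc 0 1 zero_le_one x : ℝ) with hF
  have hFc : Continuous F :=
    hgc.comp_continuous (continuous_subtype_val.comp continuous_projIcc)
      (fun x => (projIcc 0 1 zero_le_one x).2)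
  have hFe : ∀ x ∈ Icc (0:ℝ) 1, F x = (q x - μ) * y x := by
    intro x hx
    simp only [hF, projIcc_of_mem zero_le_one hx]
  set P : ℝ → ℝ := fun x => p 0 + ∫ t in (0:ℝ)..x, F t with hP
  have hPd : ∀ x, HasDerivAt P (F x) x := fun x =>
    ((hFc.integral_hasStrictDerivAt 0 x).hasDerivAt).const_add _
  have hPc : Continuous P := continuous_iff_continuousAt.2 fun x => (hPd x).continuousAt
  set Y : ℝ → ℝ := fun x => ∫ t in (0:ℝ)..x, P t with hYdef
  have hYd : ∀ x, HasDerivAt Y (P x) x := fun x => (hPc.integral_hasStrictDerivAt 0 x).hasDerivAt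
  have hdat : ∀ x ∈ Ioo (0:ℝ) 1, ContDiffAt ℝ 2 y x := fun x hx =>
    hy.contDiffOn.contDiffAt (Icc_mem_nhds hx.1 hx.2)
  have hpder : ∀ x ∈ Ioo (0:ℝ) 1, p x = deriv y x := fun x hx =>
    derivWithin_of_mem_nhds (Icc_mem_nhds hx.1 hx.2)
  have hpd : ∀ x ∈ Ioo (0:ℝ) 1, HasDerivAt p (F x) x := by
    intro x hx
    have h1 : DifferentiableAt ℝ (deriv y) x := by
      have : ContDiffAt ℝ 1 (deriv y) x := by
        exact (hdat x hx).derivWithin (by norm_num [one_add_one_eq_two])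
      exact this.differentiableAt (by norm_num)
    have h2 : deriv (deriv y) x = F x := by
      rw [hFe x (Ioo_subset_Icc_self hx)]; linarith [hy.ode x hx]
    rw [← h2]
    refine h1.hasDerivAt.congr_of_eventuallyEq ?_
    filter_upwards [Ioo_mem_nhds hx.1 hx.2] with z hz using hpder z hz
  have hPp : ∀ x ∈ Icc (0:ℝ) 1, P x = p x := by
    intro x hx
    have := intervalIntegral.integral_eq_sub_of_hasDerivAt_of_le hx.1
      (hpc.mono (Icc_subset_Icc_right hx.2)) (fun z hz => hpd z ⟨hz.1, hz.2.trans_le hx.2⟩)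
      (hFc.intervalIntegrable _ _)
    simp only [hP, this]; ring
  have hYy : EqOn Y y (Icc 0 1) := by
    intro x hx
    have := intervalIntegral.integral_eq_sub_of_hasDerivAt_of_le (f := y) (f' := P) hx.1
      (hyc.mono (Icc_subset_Icc_right hx.2)) (fun z hz => by
        have hz' : z ∈ Ioo (0:ℝ) 1 := ⟨hz.1, hz.2.trans_le hx.2⟩
        rw [hPp z (Ioo_subset_Icc_self hz'), hpder z hz']
        exact ((hdat z hz').differentiableAt (by norm_num)).hasDerivAt)
      (hPc.intervalIntegrable _ _)
    simp only [hYdef, this, hy.left, sub_zero]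
  have e1 : deriv Y = P := funext fun x => (hYd x).deriv
  have e2 : deriv P = F := funext fun x => (hPd x).deriv
  refine ⟨Y, ⟨?_, ?_⟩, hYy⟩
  · have h1 : ContDiff ℝ 1 P := contDiff_one_iff_deriv.2
      ⟨fun x => (hPd x).differentiableAt, e2 ▸ hFc⟩
    rw [show (2 : WithTop ℕ∞) = 1 + 1 by norm_num, contDiff_succ_iff_deriv]
    exact ⟨fun x => (hYd x).differentiableAt, fun h => by simp at h, e1 ▸ h1⟩
  · intro x hx
    rw [e1, e2, hFe x hx, hYy hx]

/-! ### The Prüfer angle -/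

/-- The right-hand side of the Prüfer equation for `-y'' + Q y = μ y`. -/
noncomputable def pruferField (Q : ℝ → ℝ) (μ t θ : ℝ) : ℝ :=
  Real.cos θ ^ 2 + (μ - Q t) * Real.sin θ ^ 2

theorem pruferField_eq (Q : ℝ → ℝ) (μ t θ : ℝ) :
    pruferField Q μ t θ = 1 + (μ - Q t - 1) * Real.sin θ ^ 2 := by
  rw [pruferField]; linear_combination Real.sin_sq_add_cos_sq θ

theorem abs_pruferField_sub_le {Q : ℝ → ℝ} {B : ℝ} (hB : ∀ t, |Q t| ≤ B) (μ t a b : ℝ) :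
    |pruferField Q μ t a - pruferField Q μ t b| ≤ 2 * (|μ| + B + 1) * |a - b| := by
  have h1 : pruferField Q μ t a - pruferField Q μ t b =
      (μ - Q t - 1) * (Real.sin a + Real.sin b) * (Real.sin a - Real.sin b) := by
    rw [pruferField_eq, pruferField_eq]; ring
  have h2 : |μ - Q t - 1| ≤ |μ| + B + 1 := by
    have := hB t
    have h3 := abs_sub (μ - Q t) 1
    have h4 := abs_sub μ (Q t)
    simp only [abs_one] at h3
    linarith
  have h3 : |Real.sin a + Real.sin b| ≤ 2 := by
    have := abs_add_le (Real.sin a) (Real.sin b)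
    linarith [Real.abs_sin_le_one a, Real.abs_sin_le_one b]
  rw [h1, abs_mul, abs_mul]
  have h5 : |μ - Q t - 1| * |Real.sin a + Real.sin b| ≤ (|μ| + B + 1) * 2 :=
    mul_le_mul h2 h3 (abs_nonneg _) ((abs_nonneg _).trans h2)
  calc _ ≤ ((|μ| + B + 1) * 2) * |a - b| :=
        mul_le_mul h5 (Real.abs_sin_sub_sin_le a b) (abs_nonneg _)
          ((by positivity : (0:ℝ) ≤ |μ - Q t - 1| * |Real.sin a + Real.sin b|).trans h5)
    _ = _ := by ring

/-- `θ` is the Prüfer angle, normalised by `θ 0 = 0`, on a neighbourhood of `[0,1]`. -/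
structure IsPruferAngle (Q : ℝ → ℝ) (μ : ℝ) (θ : ℝ → ℝ) : Prop where
  zero : θ 0 = 0
  continuousOn : ContinuousOn θ (Icc (-1) 2)
  hasDerivAt : ∀ t ∈ Ioo (-1 : ℝ) 2, HasDerivAt θ (pruferField Q μ t (θ t)) t

/-- The field is bounded and Lipschitz in the angle, so the solution exists on the whole time
interval. The interval `[-1,2]` leaves room for two-sided derivatives on `[0,1]`. -/
theorem exists_isPruferAngle {Q : ℝ → ℝ} (hQ : Continuous Q) {B : ℝ} (hB : ∀ t, |Q t| ≤ B)
    (μ : ℝ) : ∃ θ, IsPruferAngle Q μ θ := by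
  have hB0 : 0 ≤ B := (abs_nonneg _).trans (hB 0)
  set L : NNReal := ⟨|μ| + B + 2, by positivity⟩ with hL
  set K : NNReal := ⟨2 * (|μ| + B + 1), by positivity⟩ with hK
  -- The speed is at most `L` and times stay within distance `2` of `0`, hence the radius `2 * L`.
  have hP : IsPicardLindelof (pruferField Q μ) (tmin := -1) (tmax := 2) ⟨0, by norm_num⟩ (0:ℝ)
      (2 * L) 0 L K := by
    refine ⟨fun t _ => ?_, fun x _ => ?_, fun t _ x _ => ?_, ?_⟩
    · refine (LipschitzWith.of_dist_le_mul fun a b => ?_).lipschitzOnWith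
      rw [Real.dist_eq, Real.dist_eq]
      exact abs_pruferField_sub_le hB μ t a b
    · unfold pruferField
      fun_prop
    · rw [pruferField_eq, Real.norm_eq_abs]
      have h1 : |μ - Q t - 1| ≤ |μ| + B + 1 := by
        have := hB t
        have h3 := abs_sub (μ - Q t) 1
        have h4 := abs_sub μ (Q t)
        simp only [abs_one] at h3
        linarith
      have h2 : |(μ - Q t - 1) * Real.sin x ^ 2| ≤ |μ| + B + 1 := by
        rw [abs_mul, abs_of_nonneg (sq_nonneg (Real.sin x))]
        have := Real.sin_sq_le_one x
        nlinarith [abs_nonneg (μ - Q t - 1), sq_nonneg (Real.sin x)]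
      have h3 := abs_add_le 1 ((μ - Q t - 1) * Real.sin x ^ 2)
      simp only [abs_one] at h3
      change _ ≤ |μ| + B + 2
      linarith
    · simp; linarith
  obtain ⟨θ, h0, hd⟩ := hP.exists_eq_forall_mem_Icc_hasDerivWithinAt₀
  exact ⟨θ, h0, fun t ht => (hd t ht).continuousWithinAt,
    fun t ht => (hd t (Ioo_subset_Icc_self ht)).hasDerivAt (Icc_mem_nhds ht.1 ht.2)⟩

/-- The angle for `ν` solves the equation for `μ` up to an error `|ν - μ|`, and Grönwall's
inequality turns this into closeness at time `1`. -/
theorem continuous_pruferAngle_one {Q : ℝ → ℝ} {B : ℝ} (hB : ∀ t, |Q t| ≤ B)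
    {θ : ℝ → ℝ → ℝ} (hθ : ∀ μ, IsPruferAngle Q μ (θ μ)) : Continuous fun μ => θ μ 1 := by
  have hB0 : 0 ≤ B := (abs_nonneg _).trans (hB 0)
  rw [continuous_iff_continuousAt]
  intro μ
  set K : NNReal := ⟨2 * (|μ| + B + 1), by positivity⟩ with hK
  have key : ∀ ν, dist (θ ν 1) (θ μ 1) ≤ gronwallBound 0 K (|ν - μ| + 0) (1 - 0) := by
    intro ν
    have hmem : ∀ t ∈ Ico (0:ℝ) 1, t ∈ Ioo (-1:ℝ) 2 := fun t ht =>
      ⟨by linarith [ht.1], by linarith [ht.2]⟩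
    refine dist_le_of_approx_trajectories_ODE (v := pruferField Q μ) (K := K)
      (f' := fun t => pruferField Q ν t (θ ν t)) (g' := fun t => pruferField Q μ t (θ μ t))
      (fun t => LipschitzWith.of_dist_le_mul fun a b => ?_)
      ((hθ ν).continuousOn.mono (Icc_subset_Icc (by norm_num) (by norm_num)))
      (fun t ht => ((hθ ν).hasDerivAt t (hmem t ht)).hasDerivWithinAt) (fun t ht => ?_)
      ((hθ μ).continuousOn.mono (Icc_subset_Icc (by norm_num) (by norm_num)))
      (fun t ht => ((hθ μ).hasDerivAt t (hmem t ht)).hasDerivWithinAt) (fun t ht => ?_)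
      ?_ 1 ⟨zero_le_one, le_rfl⟩
    · rw [Real.dist_eq, Real.dist_eq]
      exact abs_pruferField_sub_le hB μ t a b
    · rw [Real.dist_eq]
      have : pruferField Q ν t (θ ν t) - pruferField Q μ t (θ ν t) =
          (ν - μ) * Real.sin (θ ν t) ^ 2 := by unfold pruferField; ring
      rw [this, abs_mul, abs_of_nonneg (sq_nonneg (Real.sin _))]
      exact mul_le_of_le_one_right (abs_nonneg _) (Real.sin_sq_le_one _)
    · simp
    · simp [(hθ ν).zero, (hθ μ).zero]
  rw [ContinuousAt, tendsto_iff_dist_tendsto_zero]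
  refine squeeze_zero (fun _ => dist_nonneg) key ?_
  have h1 := (gronwallBound_continuous_ε 0 K (1 - 0)).tendsto 0
  rw [gronwallBound_ε0_δ0] at h1
  refine h1.comp ?_
  have : Continuous fun ν : ℝ => |ν - μ| + 0 := by fun_prop
  simpa using this.tendsto μ

/-- A function which increases whenever it takes the value `c` stays above `c`. -/
theorem lt_of_pos_deriv_of_eq {f f' : ℝ → ℝ} {a b c : ℝ}
    (hf : ∀ x ∈ Icc a b, HasDerivAt f (f' x) x) (ha : c ≤ f a)
    (hpos : ∀ x ∈ Icc a b, f x = c → 0 < f' x) {x : ℝ} (hx : x ∈ Ioc a b) : c < f x := by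
  have hle : ∀ ⦃x⦄, x ∈ Icc a b → c ≤ f x :=
    image_le_of_deriv_right_lt_deriv_boundary' (f := fun _ => c) (f' := fun _ => 0)
      continuousOn_const (fun x _ => hasDerivWithinAt_const _ _ _) ha
      (fun x hx => (hf x hx).continuousAt.continuousWithinAt)
      (fun x hx => (hf x (Ico_subset_Icc_self hx)).hasDerivWithinAt)
      (fun x hx h => hpos x (Ico_subset_Icc_self hx) h.symm)
  have hx' := Ioc_subset_Icc_self hx
  -- If `f x = c`, all slopes from the left are nonpositive, contrary to `f' x > 0`.
  refine lt_of_le_of_ne (hle hx') fun h => ?_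
  have h0 := hpos x hx' h.symm
  have h1 := hasDerivWithinAt_iff_tendsto_slope.1 ((hf x hx').hasDerivWithinAt (s := Iio x))
  simp only [mem_Iio, lt_self_iff_false, not_false_eq_true, sdiff_singleton_eq_self] at h1
  refine absurd (le_of_tendsto h1 ?_) (not_le.2 h0)
  filter_upwards [Ioo_mem_nhdsLT hx.1] with y hy
  rw [slope_def_field]
  refine div_nonpos_of_nonneg_of_nonpos ?_ (by linarith [hy.2])
  rw [← h]
  linarith [hle (x := y) ⟨hy.1.le, hy.2.le.trans hx.2⟩]

theorem Icc_subset_Ioo_neg_one_two {x : ℝ} (hx : x ∈ Icc (0 : ℝ) 1) : x ∈ Ioo (-1 : ℝ) 2 :=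
  ⟨by linarith [hx.1], by linarith [hx.2]⟩

namespace IsPruferAngle

variable {Q : ℝ → ℝ} {μ : ℝ} {θ : ℝ → ℝ}

/-- The field equals `1` wherever the angle is a multiple of `π`, so such values are crossed only
upwards. -/
theorem int_mul_pi_lt (hθ : IsPruferAngle Q μ θ) {k : ℤ} {a x : ℝ} (ha : 0 ≤ a) (hax : a < x)
    (hx : x ≤ 1) (h : k * Real.pi ≤ θ a) : k * Real.pi < θ x := by
  refine lt_of_pos_deriv_of_eq (b := 1) (f' := fun t => pruferField Q μ t (θ t))
    (fun t ht => hθ.hasDerivAt t (Icc_subset_Ioo_neg_one_two ⟨ha.trans ht.1, ht.2⟩)) h ?_ ⟨hax, hx⟩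
  intro t _ h
  rw [pruferField_eq, h, Real.sin_int_mul_pi]
  norm_num

/-- At the angle `π / 2` the field is `μ - Q t < 0`; this level cannot be reached from `0`. -/
theorem one_lt_pi_div_two (hθ : IsPruferAngle Q μ θ) (hμ : ∀ t, μ < Q t) :
    θ 1 < Real.pi / 2 := by
  have := lt_of_pos_deriv_of_eq (f := fun t => -θ t) (a := 0) (b := 1) (c := -(Real.pi / 2))
    (f' := fun t => -pruferField Q μ t (θ t))
    (fun t ht => (hθ.hasDerivAt t (Icc_subset_Ioo_neg_one_two ht)).neg)
    (by simpa [hθ.zero] using Real.pi_div_two_pos.le) (fun t _ h => ?_) (x := 1) ⟨zero_lt_one, le_rfl⟩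
  · linarith
  · have : θ t = Real.pi / 2 := by linarith
    rw [pruferField, this]
    simp [hμ t]

/-- A Prüfer angle whose value at `1` is a multiple of `π` comes from an eigenfunction. -/
theorem exists_eigenfunction (hQ : Continuous Q) (hθ : IsPruferAngle Q μ θ) {k : ℤ}
    (hk : θ 1 = k * Real.pi) : ∃ y, IsSturmEigenfunction Q μ y := by
  have hmp : ∀ t, ((projIcc (-1) 2 (by norm_num) t : Icc (-1:ℝ) 2) : ℝ) ∈ Icc (-1:ℝ) 2 :=
    fun t => (projIcc (-1) 2 (by norm_num) t).2
  -- Freezing the angle outside `[-1,2]` makes the amplitude equation below continuous on the whole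
  -- line.
  set T : ℝ → ℝ := fun t => θ (projIcc (-1) 2 (by norm_num) t : Icc (-1:ℝ) 2) with hT
  have hTc : Continuous T := hθ.continuousOn.comp_continuous
    (continuous_subtype_val.comp continuous_projIcc) hmp
  have hTe : ∀ t ∈ Ioo (-1:ℝ) 2, T t = θ t := fun t ht => by
    simp only [hT, projIcc_of_mem _ (Ioo_subset_Icc_self ht)]
  -- `r' = r G` is the Prüfer amplitude equation: it makes `y = r sin θ` and `z = r cos θ` satisfy
  -- `y' = z` and `z' = (Q - μ) y`.
  set G : ℝ → ℝ := fun t => (1 + Q t - μ) * (Real.sin (T t) * Real.cos (T t)) with hG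
  have hGc : Continuous G := by fun_prop
  set r : ℝ → ℝ := fun x => Real.exp (∫ t in (0:ℝ)..x, G t) with hr
  have hrd : ∀ x, HasDerivAt r (r x * G x) x := fun x =>
    ((hGc.integral_hasStrictDerivAt 0 x).hasDerivAt).exp
  have hr0 : ∀ x, 0 < r x := fun x => Real.exp_pos _
  have hrc : Continuous r := continuous_iff_continuousAt.2 fun x => (hrd x).continuousAt
  set y : ℝ → ℝ := fun x => r x * Real.sin (θ x) with hy
  set z : ℝ → ℝ := fun x => r x * Real.cos (θ x) with hz
  have hyd : ∀ x ∈ Ioo (-1:ℝ) 2, HasDerivAt y (z x) x := by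
    intro x hx
    refine ((hrd x).mul (hθ.hasDerivAt x hx).sin).congr_deriv ?_
    simp only [hG, hTe x hx, hz, pruferField]
    linear_combination (r x * Real.cos (θ x)) * Real.sin_sq_add_cos_sq (θ x)
  have hzd : ∀ x ∈ Ioo (-1:ℝ) 2, HasDerivAt z ((Q x - μ) * y x) x := by
    intro x hx
    refine ((hrd x).mul (hθ.hasDerivAt x hx).cos).congr_deriv ?_
    simp only [hG, hTe x hx, hy, pruferField]
    linear_combination ((Q x - μ) * r x * Real.sin (θ x)) * Real.sin_sq_add_cos_sq (θ x)
  have hyc : ContinuousOn y (Ioo (-1) 2) := fun x hx => (hyd x hx).continuousAt.continuousWithinAt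
  have e1 : ∀ x ∈ Ioo (-1:ℝ) 2, deriv y x = z x := fun x hx => (hyd x hx).deriv
  have e2 : ∀ x ∈ Ioo (-1:ℝ) 2, deriv (deriv y) x = (Q x - μ) * y x := by
    intro x hx
    rw [← (hzd x hx).deriv]
    refine Filter.EventuallyEq.deriv_eq ?_
    filter_upwards [Ioo_mem_nhds hx.1 hx.2] with t ht using e1 t ht
  have hz1 : ContDiffOn ℝ 1 (deriv y) (Ioo (-1) 2) := by
    rw [show (1 : WithTop ℕ∞) = 0 + 1 by norm_num, contDiffOn_succ_iff_deriv_of_isOpen isOpen_Ioo]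
    refine ⟨?_, fun h => by simp at h, ?_⟩
    · exact DifferentiableOn.congr (f := z)
        (fun x hx => (hzd x hx).differentiableAt.differentiableWithinAt) e1
    · rw [contDiffOn_zero]
      exact ContinuousOn.congr ((hQ.continuousOn.sub continuousOn_const).mul hyc) e2
  have hy2 : ContDiffOn ℝ 2 y (Ioo (-1) 2) := by
    rw [show (2 : WithTop ℕ∞) = 1 + 1 by norm_num, contDiffOn_succ_iff_deriv_of_isOpen isOpen_Ioo]
    exact ⟨fun x hx => (hyd x hx).differentiableAt.differentiableWithinAt,
      fun h => by simp at h, hz1⟩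
  have hmem0 : (0:ℝ) ∈ Ioo (-1:ℝ) 2 := by norm_num
  refine ⟨y, hy2.mono fun x hx => Icc_subset_Ioo_neg_one_two hx, ?_, ?_, ?_, ?_⟩
  · simp [hy, hθ.zero]
  · simp [hy, hk]
  · intro x hx
    rw [e2 x (Icc_subset_Ioo_neg_one_two (Ioo_subset_Icc_self hx))]
    ring
  -- If `y` vanished on `(0,1)`, its derivative at `0` would be zero, but it is `r 0 > 0`.
  · by_contra! hcon
    have h1 : HasDerivWithinAt y (z 0) (Ioo 0 1) 0 := (hyd 0 hmem0).hasDerivWithinAt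
    have h2 : HasDerivWithinAt y 0 (Ioo 0 1) 0 :=
      (hasDerivWithinAt_const (0:ℝ) (Ioo 0 1) (0:ℝ)).congr hcon (by simp [hy, hθ.zero])
    have h3 : UniqueDiffWithinAt ℝ (Ioo (0:ℝ) 1) 0 := by
      refine uniqueDiffWithinAt_convex (convex_Ioo 0 1) (by simp) ?_
      rw [closure_Ioo zero_ne_one]; simp
    have h4 := h3.eq_deriv _ h1 h2
    simp only [hz, hθ.zero, Real.cos_zero, mul_one] at h4
    exact (hr0 0).ne' h4

end IsPruferAngle

/-! ### Counting zeros of eigenfunctions -/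

/-- `f` vanishes at `0`, at `1` and at `N` (or more) points of `(0,1)`: the zeros
`0 = p 0 < p 1 < ⋯ < p N < p (N + 1) = 1` are followed by a constant sequence. -/
def HasZeroChain (f : ℝ → ℝ) (N : ℕ) : Prop :=
  ∃ p : ℕ → ℝ, p 0 = 0 ∧ (∀ i, N < i → p i = 1) ∧ (∀ i ≤ N, p i < p (i + 1)) ∧
    ∀ i, p i ∈ Icc (0 : ℝ) 1 ∧ f (p i) = 0

theorem HasZeroChain.congr {f g : ℝ → ℝ} {N : ℕ} (h : HasZeroChain f N)
    (hfg : EqOn f g (Icc 0 1)) : HasZeroChain g N := by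
  obtain ⟨p, h0, h1, h2, h3⟩ := h
  exact ⟨p, h0, h1, h2, fun i => ⟨(h3 i).1, by rw [← hfg (h3 i).1, (h3 i).2]⟩⟩

/-- The Prüfer angle counts the zeros of a solution. -/
theorem IsRegularSolution.mul_pi_le_pruferAngle {q : ℝ → ℝ} {μ : ℝ} {Y θ : ℝ → ℝ}
    (hY : IsRegularSolution q μ Y) (hq : Continuous q) (hθ : IsPruferAngle q μ θ)
    (hne : ∃ x ∈ Icc (0 : ℝ) 1, Y x ≠ 0) {N : ℕ} (hZ : HasZeroChain Y N) :
    (N + 1 : ℕ) * Real.pi ≤ θ 1 := by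
  obtain ⟨p, hp0, hp1, hlt, hz⟩ := hZ
  obtain ⟨C, hC⟩ := isCompact_Icc.exists_bound_of_continuousOn
    (f := fun x => 1 + q x - μ) (s := Icc (0:ℝ) 1) (by fun_prop)
  simp only [Real.norm_eq_abs] at hC
  -- `W` vanishes exactly when `(Y, Y')` is parallel to `(sin θ, cos θ)`. It satisfies a homogeneous
  -- linear equation and `W 0 = 0`, so it is zero throughout; as zeros of `Y` are simple, they force
  -- `sin θ = 0`.
  set W : ℝ → ℝ := fun x => Y x * Real.cos (θ x) - deriv Y x * Real.sin (θ x) with hW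
  have hWd : ∀ x ∈ Icc (0:ℝ) 1, HasDerivAt W
      (-(1 + q x - μ) * (Real.sin (θ x) * Real.cos (θ x)) * W x) x := by
    intro x hx
    have hd := hθ.hasDerivAt x (Icc_subset_Ioo_neg_one_two hx)
    refine (((hY.hasDerivAt x).mul hd.cos).sub ((hY.hasDerivAt_deriv hx).mul hd.sin)).congr_deriv ?_
    simp only [hW, pruferField]
    linear_combination (-deriv Y x * Real.cos (θ x) + Y x * Real.sin (θ x) * (q x - μ)) *
      Real.sin_sq_add_cos_sq (θ x)
  have hW0 : ∀ x ∈ Icc (0:ℝ) 1, W x = 0 := by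
    refine eq_zero_of_abs_deriv_le_mul_abs_self_of_eq_zero_right (K := C)
      (f' := fun x => -(1 + q x - μ) * (Real.sin (θ x) * Real.cos (θ x)) * W x)
      (fun x hx => (hWd x hx).continuousAt.continuousWithinAt)
      (fun x hx => (hWd x (Ico_subset_Icc_self hx)).hasDerivWithinAt) ?_ ?_
    · simp only [hW, hθ.zero, Real.sin_zero, mul_zero, sub_zero]
      have := (hz 0).2
      rw [hp0] at this
      simp [this]
    · intro x hx
      rw [Real.norm_eq_abs, Real.norm_eq_abs, abs_mul, abs_mul, abs_neg, abs_mul]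
      refine mul_le_mul_of_nonneg_right ?_ (abs_nonneg _)
      have h1 := hC x (Ico_subset_Icc_self hx)
      have h2 : |Real.sin (θ x)| * |Real.cos (θ x)| ≤ 1 :=
        mul_le_one₀ (Real.abs_sin_le_one _) (abs_nonneg _) (Real.abs_cos_le_one _)
      exact (mul_le_of_le_one_right (abs_nonneg _) h2).trans h1
  have hpi : ∀ x ∈ Icc (0:ℝ) 1, Y x = 0 → ∃ k : ℤ, k * Real.pi = θ x := by
    intro x hx h0
    rw [← Real.sin_eq_zero_iff]
    have h1 := hW0 x hx
    simp only [hW, h0, zero_mul, zero_sub, neg_eq_zero, mul_eq_zero] at h1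
    refine h1.resolve_left fun h1 => ?_
    obtain ⟨t, ht, hne⟩ := hne
    exact hne (hY.eq_zero_of_double_zero hq.continuousOn hx h0 h1 t ht)
  have main : ∀ i ≤ N + 1, (i : ℕ) * Real.pi ≤ θ (p i) := by
    intro i
    induction i with
    | zero => intro _; simp [hp0, hθ.zero]
    | succ i ih =>
      intro hi
      have h1 := ih (by omega)
      have h2 : ((i : ℤ) : ℝ) * Real.pi < θ (p (i + 1)) :=
        hθ.int_mul_pi_lt (hz i).1.1 (hlt i (by omega)) (hz (i+1)).1.2 (by exact_mod_cast h1)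
      obtain ⟨k, hk⟩ := hpi _ (hz (i+1)).1 (hz (i+1)).2
      rw [← hk] at h2 ⊢
      have h3 : (i : ℤ) < k := by
        have := lt_of_mul_lt_mul_right h2 Real.pi_pos.le
        exact_mod_cast this
      refine mul_le_mul_of_nonneg_right ?_ Real.pi_pos.le
      have h4 : (i : ℤ) + 1 ≤ k := by omega
      push_cast
      exact_mod_cast h4
  have := main (N + 1) le_rfl
  rwa [hp1 (N + 1) (by omega)] at this

theorem IsSturmEigenfunction.congr_potential {q Q : ℝ → ℝ} {μ : ℝ} {y : ℝ → ℝ}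
    (h : IsSturmEigenfunction q μ y) (hqQ : EqOn q Q (Icc 0 1)) : IsSturmEigenfunction Q μ y :=
  ⟨h.contDiffOn, h.left, h.right,
    fun x hx => by rw [← hqQ (Ioo_subset_Icc_self hx)]; exact h.ode x hx, h.nontrivial⟩

/-- The `j`-th eigenfunction (counted from `0`) has at most `j` zeros in `(0,1)`. -/
theorem IsSturmEigenpairs.zeros_le {q : ℝ → ℝ} {lam : ℕ → ℝ} {h : ℕ → ℝ → ℝ}
    (hh : IsSturmEigenpairs q lam h) (hq : Continuous q) {B : ℝ} (hB : ∀ t, |q t| ≤ B)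
    {j N : ℕ} (hZ : HasZeroChain (h j) N) : N ≤ j := by
  choose θ hθ using fun μ => exists_isPruferAngle hq hB μ
  have hcont := continuous_pruferAngle_one hB hθ
  obtain ⟨Y, hY, hYe⟩ := (hh.eigen j).exists_extension hq.continuousOn
  have htop : (N + 1 : ℕ) * Real.pi ≤ θ (lam j) 1 := by
    refine hY.mul_pi_le_pruferAngle hq (hθ _) ?_ (hZ.congr hYe.symm)
    obtain ⟨x, hx, hne⟩ := (hh.eigen j).nontrivial
    exact ⟨x, Ioo_subset_Icc_self hx, by rwa [hYe (Ioo_subset_Icc_self hx)]⟩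
  -- A parameter below every value of the potential, where the angle at `1` has not yet reached `π /
  -- 2`.
  set a := min (lam j) (-B) - 1 with ha
  have haj : a ≤ lam j := by have := min_le_left (lam j) (-B); linarith
  have hlow : θ a 1 < Real.pi / 2 := by
    refine (hθ a).one_lt_pi_div_two fun t => ?_
    have := min_le_right (lam j) (-B)
    have := (abs_le.1 (hB t)).1
    linarith
  -- The value `(k + 1)π`, for `k < N`, is attained strictly between `a` and `lam j`, at an
  -- eigenvalue. Distinct `k` give distinct eigenvalues, so `range N` injects into `range j`.
  have hex : ∀ k : ℕ, ∃ i : ℕ, k < N → (i < j ∧ θ (lam i) 1 = (k + 1 : ℕ) * Real.pi) := by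
    intro k
    by_cases hk : k < N
    · have hpi := Real.pi_pos
      have h1 : ((k + 1 : ℕ) : ℝ) * Real.pi ∈ Ioo (θ a 1) (θ (lam j) 1) := by
        constructor
        · push_cast; nlinarith [(Nat.cast_nonneg k : (0:ℝ) ≤ k)]
        · refine lt_of_lt_of_le ?_ htop
          refine mul_lt_mul_of_pos_right ?_ hpi
          exact_mod_cast by omega
      obtain ⟨ν, hν, hνe⟩ := intermediate_value_Ioo haj hcont.continuousOn h1
      obtain ⟨y, hy⟩ := (hθ ν).exists_eigenfunction hq (k := (k + 1 : ℕ)) (by exact_mod_cast hνe)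
      obtain ⟨i, hi⟩ := hh.exhaust ν y hy
      refine ⟨i, fun _ => ⟨?_, by rw [hi]; exact hνe⟩⟩
      rw [← hh.strictMono.lt_iff_lt, hi]
      exact hν.2
    · exact ⟨0, fun h => absurd h hk⟩
  choose i hi using hex
  have := Finset.card_le_card_of_injOn (s := Finset.range N) (t := Finset.range j) i
    (fun k hk => by
      have := (hi k (by simpa using hk)).1
      simpa using this)
    (fun k hk l hl hkl => by
      have h1 := (hi k (by simpa using hk)).2
      have h2 := (hi l (by simpa using hl)).2
      rw [hkl, h2] at h1
      have h3 := mul_right_cancel₀ Real.pi_pos.ne' h1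
      have h4 : l + 1 = k + 1 := by exact_mod_cast h3
      omega)
  simpa using this

/-! ### Sturm's theorem on linear combinations of eigenfunctions -/

/-- Global `C²` representatives of the eigenfunctions, together with the bound on the number of
their zeros. -/
structure IsRegularEigenbasis (q : ℝ → ℝ) (lam : ℕ → ℝ) (Y : ℕ → ℝ → ℝ) : Prop where
  strictMono : StrictMono lam
  continuous : Continuous q
  regular : ∀ j, IsRegularSolution q (lam j) (Y j)
  left : ∀ j, Y j 0 = 0
  right : ∀ j, Y j 1 = 0
  nontrivial : ∀ j, ∃ x ∈ Icc (0 : ℝ) 1, Y j x ≠ 0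
  zeros_le : ∀ j N, HasZeroChain (Y j) N → N ≤ j

theorem HasZeroChain.const_mul {f : ℝ → ℝ} {N : ℕ} (h : HasZeroChain f N) (c : ℝ) :
    HasZeroChain (fun x => c * f x) N := by
  obtain ⟨p, h0, h1, h2, h3⟩ := h
  exact ⟨p, h0, h1, h2, fun i => ⟨(h3 i).1, by simp [(h3 i).2]⟩⟩

theorem lt_of_forall_lt_succ {p : ℕ → ℝ} {N : ℕ} (h : ∀ i ≤ N, p i < p (i + 1)) {i j : ℕ}
    (hij : i < j) (hj : j ≤ N + 1) : p i < p j := by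
  induction j with
  | zero => omega
  | succ j ih =>
    rcases Nat.lt_succ_iff_lt_or_eq.1 hij with h1 | rfl
    · exact (ih h1 (by omega)).trans (h j (by omega))
    · exact h i (by omega)

/-- Sturm's step: applying `-d²/dx² + q - λ₀`, where `λ₀` has an eigenfunction without zeros in
`(0,1)`, does not decrease the number of zeros. -/
theorem HasZeroChain.sturm_step {q w f f₁ f₂ : ℝ → ℝ} {μ : ℝ} {N : ℕ}
    (hw : IsRegularSolution q μ w) (hw0 : w 0 = 0) (hw1 : w 1 = 0)
    (hwne : ∀ x ∈ Ioo (0 : ℝ) 1, w x ≠ 0)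
    (hf : ∀ x ∈ Icc (0 : ℝ) 1, HasDerivAt f (f₁ x) x)
    (hf₁ : ∀ x ∈ Icc (0 : ℝ) 1, HasDerivAt f₁ (f₂ x) x)
    (hg0 : f₂ 0 = (q 0 - μ) * f 0) (hg1 : f₂ 1 = (q 1 - μ) * f 1)
    (hZ : HasZeroChain f N) : HasZeroChain (fun x => (q x - μ) * f x - f₂ x) N := by
  obtain ⟨p, hp0, hp1, hlt, hz⟩ := hZ
  -- This Wronskian is used twice: `(f / w)' = W / w²`, and `W' = -g w` with `g = (q - μ) f - f₂`.
  set W : ℝ → ℝ := fun x => f₁ x * w x - f x * deriv w x with hW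
  have hWd : ∀ x ∈ Icc (0:ℝ) 1, HasDerivAt W (f₂ x * w x - f x * ((q x - μ) * w x)) x := by
    intro x hx
    exact (((hf₁ x hx).mul (hw.hasDerivAt x)).sub
      ((hf x hx).mul (hw.hasDerivAt_deriv hx))).congr_deriv (by ring)
  have hpos : ∀ i, 1 ≤ i → i ≤ N → p i ∈ Ioo (0:ℝ) 1 := fun i h1 h2 =>
    ⟨hp0 ▸ lt_of_forall_lt_succ hlt (i := 0) (j := i) (by omega) (by omega),
      (hp1 (N + 1) (by omega)) ▸ lt_of_forall_lt_succ hlt (i := i) (j := N + 1) (by omega) le_rfl⟩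
  -- Zeros of `W`: `d 0 = 0`, `d N = 1`, and for `0 < i < N` a Rolle point of `f / w` between `p i`
  -- and `p (i + 1)`. The quotient is not used at the endpoints, where `w` vanishes, but `W`
  -- vanishes there anyway. For `N = 0` the two prescriptions for `d 0` would clash.
  have hd : ∀ i, ∃ d, 1 ≤ N → i ≤ N → d ∈ Icc (0:ℝ) 1 ∧ W d = 0 ∧ (i < N → d < p (i + 1)) ∧
      (1 ≤ i → p i < d) := by
    intro i
    rcases Nat.eq_zero_or_pos i with rfl | hi
    · refine ⟨0, fun hN _ => ⟨by simp, ?_, fun _ => (hpos 1 le_rfl hN).1, by omega⟩⟩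
      have := (hz 0).2
      rw [hp0] at this
      simp [hW, hw0, this]
    rcases lt_trichotomy i N with hiN | rfl | hiN
    · have h1 := hpos i hi hiN.le
      have h2 := hpos (i + 1) (by omega) hiN
      have hsub : ∀ x ∈ Icc (p i) (p (i + 1)), x ∈ Ioo (0:ℝ) 1 := fun x hx =>
        ⟨h1.1.trans_le hx.1, hx.2.trans_lt h2.2⟩
      have hder : ∀ x ∈ Icc (p i) (p (i + 1)),
          HasDerivAt (fun x => f x / w x) (W x / w x ^ 2) x := fun x hx =>
        (hf x (Ioo_subset_Icc_self (hsub x hx))).div (hw.hasDerivAt x) (hwne x (hsub x hx))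
      obtain ⟨c, hc, hc0⟩ := exists_hasDerivAt_eq_zero (hlt i hiN.le)
        (fun x hx => (hder x hx).continuousAt.continuousWithinAt)
        (by simp [(hz i).2, (hz (i+1)).2]) (fun x hx => hder x (Ioo_subset_Icc_self hx))
      refine ⟨c, fun _ _ => ⟨Ioo_subset_Icc_self (hsub c (Ioo_subset_Icc_self hc)), ?_,
        fun _ => hc.2, fun _ => hc.1⟩⟩
      have := hwne c (hsub c (Ioo_subset_Icc_self hc))
      simpa [this] using hc0
    · refine ⟨1, fun hN _ => ⟨by simp, ?_, by omega, fun _ => (hpos i hi le_rfl).2⟩⟩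
      have := (hz (i + 1)).2
      rw [hp1 (i + 1) (by omega)] at this
      simp [hW, hw1, this]
    · exact ⟨0, by omega⟩
  rcases Nat.eq_zero_or_pos N with rfl | hN
  · refine ⟨p, hp0, hp1, hlt, fun i => ⟨(hz i).1, ?_⟩⟩
    rcases Nat.eq_zero_or_pos i with rfl | hi
    · simp [hp0, hg0]
    · simp [hp1 i hi, hg1]
  choose d hd using hd
  have hdlt : ∀ i < N, d i < d (i + 1) := fun i hi =>
    ((hd i hN hi.le).2.2.1 hi).trans ((hd (i + 1) hN hi).2.2.2 (by omega))
  -- Rolle's theorem for `W` on the `N` intervals between its zeros gives `N` zeros of `g`, because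
  -- `w` has none inside.
  have he : ∀ i, ∃ e, i < N → d i < e ∧ e < d (i + 1) ∧ (q e - μ) * f e - f₂ e = 0 := by
    intro i
    by_cases hi : i < N
    · have hsub : ∀ x ∈ Icc (d i) (d (i + 1)), x ∈ Icc (0:ℝ) 1 := fun x hx =>
        ⟨(hd i hN hi.le).1.1.trans hx.1, hx.2.trans (hd (i + 1) hN hi).1.2⟩
      obtain ⟨c, hc, hc0⟩ := exists_hasDerivAt_eq_zero (hdlt i hi)
        (fun x hx => (hWd x (hsub x hx)).continuousAt.continuousWithinAt)
        (by rw [(hd i hN hi.le).2.1, (hd (i+1) hN hi).2.1])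
        (fun x hx => hWd x (hsub x (Ioo_subset_Icc_self hx)))
      refine ⟨c, fun _ => ⟨hc.1, hc.2, ?_⟩⟩
      have hcI : c ∈ Ioo (0:ℝ) 1 := ⟨(hd i hN hi.le).1.1.trans_lt hc.1,
        hc.2.trans_le (hd (i + 1) hN hi).1.2⟩
      have h1 : ((q c - μ) * f c - f₂ c) * w c = 0 := by linear_combination -hc0
      exact (mul_eq_zero.1 h1).resolve_right (hwne c hcI)
    · exact ⟨0, fun h => absurd h hi⟩
  choose e he using he
  refine ⟨fun i => if i = 0 then 0 else if i ≤ N then e (i - 1) else 1, by simp, ?_, ?_, ?_⟩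
  · intro i hi
    simp [show i ≠ 0 by omega, show ¬ i ≤ N by omega]
  · intro i hi
    rcases Nat.eq_zero_or_pos i with rfl | hi0
    · simp only [if_true, zero_add, one_ne_zero, if_false, show 1 ≤ N from hN, Nat.sub_self]
      exact (hd 0 hN (by omega)).1.1.trans_lt (he 0 hN).1
    · have e1 := he (i - 1) (by omega)
      rw [show i - 1 + 1 = i by omega] at e1
      simp only [show i ≠ 0 by omega, if_false, hi, if_true, Nat.succ_ne_zero,
        Nat.add_sub_cancel]
      split_ifs with h
      · exact e1.2.1.trans (he i (by omega)).1
      · exact e1.2.1.trans_le (hd i hN hi).1.2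
  · intro i
    dsimp only
    split_ifs with h1 h2
    · simp [hg0]
    · have e1 := he (i - 1) (by omega)
      exact ⟨⟨((hd (i - 1) hN (by omega)).1.1.trans_lt e1.1).le,
        (e1.2.1.trans_le (hd _ hN (by omega)).1.2).le⟩, e1.2.2⟩
    · simp [hg1]

/-- Zeros persist under `C¹` convergence towards a function without double zeros. -/
theorem HasZeroChain.of_tendsto {F F' : ℕ → ℝ → ℝ} {G G' : ℝ → ℝ} {N : ℕ}
    (hF : ∀ m x, HasDerivAt (F m) (F' m x) x)
    (hlim : ∀ (φ : ℕ → ℕ) (x : ℕ → ℝ) (c : ℝ), StrictMono φ → Tendsto x atTop (𝓝 c) →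
      Tendsto (fun m => F (φ m) (x m)) atTop (𝓝 (G c)))
    (hlim' : ∀ (φ : ℕ → ℕ) (x : ℕ → ℝ) (c : ℝ), StrictMono φ → Tendsto x atTop (𝓝 c) →
      Tendsto (fun m => F' (φ m) (x m)) atTop (𝓝 (G' c)))
    (hG : ∀ c ∈ Icc (0 : ℝ) 1, G c = 0 → G' c ≠ 0)
    (hZ : ∀ m, HasZeroChain (F m) N) : HasZeroChain G N := by
  choose p hp0 hp1 hlt hz using hZ
  -- The chains lie in the compact space `[0,1]^ℕ`, so a subsequence converges in every coordinate.
  have hK : IsCompact (Set.pi univ fun _ : ℕ => Icc (0:ℝ) 1) :=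
    isCompact_univ_pi fun _ => isCompact_Icc
  obtain ⟨P, hP, φ, hφ, hPlim⟩ := hK.tendsto_subseq (x := p) fun m i _ => (hz m i).1
  rw [tendsto_pi_nhds] at hPlim
  have hPz : ∀ i, G (P i) = 0 := by
    intro i
    have h1 := hlim φ (fun m => p (φ m) i) (P i) hφ (hPlim i)
    simp only [(hz _ i).2] at h1
    exact tendsto_nhds_unique h1 tendsto_const_nhds
  refine ⟨P, ?_, ?_, ?_, fun i => ⟨hP i (mem_univ i), hPz i⟩⟩
  · have := hPlim 0
    simp only [Function.comp_def, hp0] at this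
    exact tendsto_nhds_unique this tendsto_const_nhds
  · intro i hi
    have := hPlim i
    simp only [Function.comp_def, hp1 _ i hi] at this
    exact tendsto_nhds_unique this tendsto_const_nhds
  -- If two consecutive zeros merged, the Rolle points of `F (φ m)` between them would converge to
  -- the same place, a double zero of `G`.
  · intro i hi
    refine lt_of_le_of_ne (le_of_tendsto_of_tendsto' (hPlim i) (hPlim (i + 1))
      fun m => (hlt (φ m) i hi).le) fun heq => ?_
    have hR : ∀ m, ∃ c ∈ Ioo (p (φ m) i) (p (φ m) (i + 1)), F' (φ m) c = 0 := fun m =>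
      exists_hasDerivAt_eq_zero (hlt _ i hi)
        (fun x _ => (hF (φ m) x).continuousAt.continuousWithinAt)
        (by rw [(hz _ i).2, (hz _ (i+1)).2]) (fun x _ => hF (φ m) x)
    choose c hc hc0 using hR
    have hcl : Tendsto c atTop (𝓝 (P i)) :=
      tendsto_of_tendsto_of_tendsto_of_le_of_le (hPlim i) (heq ▸ hPlim (i + 1))
        (fun m => (hc m).1.le) (fun m => (hc m).2.le)
    have h1 := hlim' φ c (P i) hφ hcl
    simp only [hc0] at h1
    exact hG _ (hP i (mem_univ i)) (hPz i) (tendsto_nhds_unique h1 tendsto_const_nhds)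

theorem tendsto_sum_pow_mul {J : ℕ} {b a : ℕ → ℝ} {Z : ℕ → ℝ → ℝ} (hb : ∀ j < J, |b j| < 1)
    (hbJ : b J = 1) (hZ : ∀ j, Continuous (Z j)) {φ : ℕ → ℕ} (hφ : StrictMono φ) {x : ℕ → ℝ}
    {c : ℝ} (hx : Tendsto x atTop (𝓝 c)) :
    Tendsto (fun m => ∑ j ∈ Finset.range (J + 1), a j * b j ^ φ m * Z j (x m)) atTop
      (𝓝 (a J * Z J c)) := by
  have hZc : ∀ j, Tendsto (fun m => Z j (x m)) atTop (𝓝 (Z j c)) := fun j =>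
    ((hZ j).tendsto c).comp hx
  simp only [Finset.sum_range_succ, hbJ, one_pow, mul_one]
  have h1 : Tendsto (fun m => ∑ j ∈ Finset.range J, a j * b j ^ φ m * Z j (x m)) atTop
      (𝓝 (∑ j ∈ Finset.range J, a j * 0 * Z j c)) := by
    refine tendsto_finsetSum _ fun j hj => ?_
    refine (Tendsto.mul tendsto_const_nhds ?_).mul (hZc j)
    exact (tendsto_pow_atTop_nhds_zero_of_abs_lt_one (hb j (by simpa using hj))).comp
      hφ.tendsto_atTop
  simpa using h1.add ((tendsto_const_nhds (x := a J)).mul (hZc J))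

namespace IsRegularEigenbasis

variable {q : ℝ → ℝ} {lam : ℕ → ℝ} {Y : ℕ → ℝ → ℝ}

theorem ground_ne_zero (hY : IsRegularEigenbasis q lam Y) {x : ℝ} (hx : x ∈ Ioo (0 : ℝ) 1) :
    Y 0 x ≠ 0 := by
  intro h0
  have : HasZeroChain (Y 0) 1 := by
    refine ⟨fun i => if i = 0 then 0 else if i = 1 then x else 1, by simp, ?_, ?_, ?_⟩
    · intro i hi; simp [show i ≠ 0 by omega, show i ≠ 1 by omega]
    · intro i hi; interval_cases i <;> simp [hx.1, hx.2]
    · intro i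
      dsimp only
      split_ifs
      · simp [hY.left]
      · exact ⟨Ioo_subset_Icc_self hx, h0⟩
      · simp [hY.right]
  have := hY.zeros_le 0 1 this
  omega

/-- On eigenfunctions the operator is diagonal: it multiplies the `j`-th coefficient by `lam j - lam
0`. -/
theorem sturm_step (hY : IsRegularEigenbasis q lam Y) (a : ℕ → ℝ) {J N : ℕ}
    (hZ : HasZeroChain (fun x => ∑ j ∈ Finset.range J, a j * Y j x) N) :
    HasZeroChain (fun x => ∑ j ∈ Finset.range J, (a j * (lam j - lam 0)) * Y j x) N := by
  have hf : ∀ x ∈ Icc (0:ℝ) 1, HasDerivAt (fun x => ∑ j ∈ Finset.range J, a j * Y j x)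
      (∑ j ∈ Finset.range J, a j * deriv (Y j) x) x := fun x _ =>
    HasDerivAt.fun_sum fun j _ => ((hY.regular j).hasDerivAt x).const_mul (a j)
  have hf₁ : ∀ x ∈ Icc (0:ℝ) 1, HasDerivAt (fun x => ∑ j ∈ Finset.range J, a j * deriv (Y j) x)
      (∑ j ∈ Finset.range J, a j * ((q x - lam j) * Y j x)) x := fun x hx =>
    HasDerivAt.fun_sum fun j _ => ((hY.regular j).hasDerivAt_deriv hx).const_mul (a j)
  refine (hZ.sturm_step (hY.regular 0) (hY.left 0) (hY.right 0) (fun x => hY.ground_ne_zero)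
    hf hf₁ ?_ ?_).congr ?_
  · simp [hY.left]
  · simp [hY.right]
  · intro x _
    simp only [Finset.mul_sum, ← Finset.sum_sub_distrib]
    exact Finset.sum_congr rfl fun j _ => by ring

/-- Sturm's theorem: a combination of the eigenfunctions `0, …, J` which involves the last one has
at most `J` zeros in `(0,1)`. -/
theorem zeros_sum_le (hY : IsRegularEigenbasis q lam Y) {a : ℕ → ℝ} {J N : ℕ} (ha : a J ≠ 0)
    (hZ : HasZeroChain (fun x => ∑ j ∈ Finset.range (J + 1), a j * Y j x) N) : N ≤ J := by
  rcases Nat.eq_zero_or_pos J with rfl | hJ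
  · refine hY.zeros_le 0 N ((hZ.const_mul (a 0)⁻¹).congr fun x _ => ?_)
    simp [ha]
  have hl : 0 < lam J - lam 0 := sub_pos.2 (hY.strictMono hJ)
  -- Normalised factors: `|b j| < 1` for `j < J` and `b J = 1`, so iteration isolates the mode `J`.
  set b : ℕ → ℝ := fun j => (lam j - lam 0) / (lam J - lam 0) with hb
  have hb1 : ∀ j < J, |b j| < 1 := by
    intro j hj
    have h1 := hY.strictMono hj
    have h2 := hY.strictMono.monotone (Nat.zero_le j)
    rw [abs_of_nonneg (div_nonneg (by linarith) hl.le), div_lt_one hl]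
    linarith
  have hbJ : b J = 1 := div_self hl.ne'
  have hiter : ∀ m : ℕ,
      HasZeroChain (fun x => ∑ j ∈ Finset.range (J + 1), a j * b j ^ m * Y j x) N := by
    intro m
    induction m with
    | zero => simpa using hZ
    | succ m ih =>
      refine ((hY.sturm_step _ ih).const_mul (lam J - lam 0)⁻¹).congr fun x _ => ?_
      simp only [Finset.mul_sum, hb]
      exact Finset.sum_congr rfl fun j _ => by rw [pow_succ]; field_simp
  refine hY.zeros_le J N ?_
  refine ((HasZeroChain.of_tendsto (G := fun x => a J * Y J x) (G' := fun x => a J * deriv (Y J) x)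
    (F' := fun m x => ∑ j ∈ Finset.range (J + 1), a j * b j ^ m * deriv (Y j) x)
    (fun m x => HasDerivAt.fun_sum fun j _ => ((hY.regular j).hasDerivAt x).const_mul _)
    (fun φ x c hφ hx => tendsto_sum_pow_mul hb1 hbJ
      (fun j => (hY.regular j).contDiff.continuous) hφ hx)
    (fun φ x c hφ hx => tendsto_sum_pow_mul hb1 hbJ
      (fun j => (hY.regular j).contDiff_deriv.continuous) hφ hx) ?_ hiter).const_mul
      (a J)⁻¹).congr fun x _ => by simp [ha]
  intro c hc h0 h1
  obtain ⟨t, ht, hne⟩ := hY.nontrivial J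
  exact hne ((hY.regular J).eq_zero_of_double_zero hY.continuous.continuousOn hc
    (by simpa [ha] using h0) (by simpa [ha] using h1) t ht)

/-- Descending to the last nonzero coefficient reduces this to `zeros_sum_le`. -/
theorem zeros_sum_lt (hY : IsRegularEigenbasis q lam Y) {a : ℕ → ℝ} {n N : ℕ}
    (ha : ∃ j < n, a j ≠ 0)
    (hZ : HasZeroChain (fun x => ∑ j ∈ Finset.range n, a j * Y j x) N) : N < n := by
  induction n with
  | zero => obtain ⟨j, hj, _⟩ := ha; omega
  | succ n ih =>
    by_cases h0 : a n = 0
    · obtain ⟨j, hj, hne⟩ := ha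
      have hjn : j ≠ n := fun h => hne (h ▸ h0)
      have := ih ⟨j, by omega, hne⟩ (by simpa [Finset.sum_range_succ, h0] using hZ)
      omega
    · exact Nat.lt_succ_of_le (hY.zeros_sum_le h0 hZ)

/-- The Slater determinant does not vanish in the open simplex. -/
theorem slater_ne_zero (hY : IsRegularEigenbasis q lam Y) {n : ℕ} {c : Fin n → ℝ}
    (hc : c ∈ simplex n) : slater Y n c ≠ 0 := by
  intro h0
  rw [slater, ← Matrix.exists_vecMul_eq_zero_iff] at h0
  obtain ⟨v, hv, hv0⟩ := h0
  set a : ℕ → ℝ := fun j => if h : j < n then v ⟨j, h⟩ else 0 with ha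
  have hsum : ∀ x, ∑ j ∈ Finset.range n, a j * Y j x = ∑ i : Fin n, v i * Y i x := by
    intro x
    rw [Finset.sum_range]
    exact Finset.sum_congr rfl fun i _ => by simp [ha]
  have hzero : ∀ j : Fin n, ∑ i : Fin n, v i * Y i (c j) = 0 := fun j => by
    simpa [Matrix.vecMul, dotProduct] using congrFun hv0 j
  have hane : ∃ j < n, a j ≠ 0 := by
    obtain ⟨i, hi⟩ := Function.ne_iff.1 hv
    exact ⟨i, i.2, by simpa [ha] using hi⟩
  have := hY.zeros_sum_lt (N := n) hane ?_
  · omega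
  -- The chain `0, c 0, …, c (n - 1), 1` has `n` interior zeros, one more than allowed.
  refine ⟨fun i => if i = 0 then 0 else if h : i - 1 < n then c ⟨i - 1, h⟩ else 1, by simp, ?_, ?_,
    ?_⟩
  · intro i hi
    simp [show i ≠ 0 by omega, show ¬ i - 1 < n by omega]
  · intro i hi
    rcases Nat.eq_zero_or_pos i with rfl | hi0
    · by_cases hn : 0 < n
      · simpa [hn] using (hc.1 ⟨0, hn⟩).1
      · simp [hn]
    · by_cases hin : i < n
      · simp only [show i ≠ 0 by omega, if_false, show i - 1 < n by omega, dif_pos,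
          Nat.succ_ne_zero, Nat.add_sub_cancel, hin]
        exact hc.2 (by simp [Fin.lt_def]; omega)
      · simp only [show i ≠ 0 by omega, if_false, show i - 1 < n by omega, dif_pos,
          Nat.succ_ne_zero, Nat.add_sub_cancel, hin, dif_neg, not_false_eq_true]
        exact (hc.1 _).2
  · intro i
    dsimp only
    split_ifs with h1 h2
    · simp [hY.left]
    · exact ⟨Ioo_subset_Icc_self (hc.1 _), by rw [hsum]; exact hzero _⟩
    · simp [hY.right]

end IsRegularEigenbasis

/-! ### Test functions and integration by parts -/

section TestFunctions

variable {n : ℕ} {Ω : Set (Fin n → ℝ)} {φ a : (Fin n → ℝ) → ℝ}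

theorem continuous_partialDeriv (hφ : ContDiff ℝ 1 φ) (i : Fin n) :
    Continuous (partialDeriv i φ) :=
  (hφ.continuous_fderiv (by norm_num)).clm_apply continuous_const

theorem partialDeriv_eq_zero_of_notMem_tsupport {x : Fin n → ℝ} (hx : x ∉ tsupport φ)
    (i : Fin n) : partialDeriv i φ x = 0 := by
  have h : φ =ᶠ[𝓝 x] fun _ => 0 := notMem_tsupport_iff_eventuallyEq.1 hx
  simp [partialDeriv, h.fderiv_eq]

theorem partialDeriv_mul {f g : (Fin n → ℝ) → ℝ} {x : Fin n → ℝ} (hf : DifferentiableAt ℝ f x)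
    (hg : DifferentiableAt ℝ g x) (i : Fin n) :
    partialDeriv i (fun x => f x * g x) x = f x * partialDeriv i g x + g x * partialDeriv i f x := by
  simp [partialDeriv, fderiv_fun_mul hf hg]

theorem hasCompactSupport_partialDeriv (hc : HasCompactSupport φ) (i : Fin n) :
    HasCompactSupport (partialDeriv i φ) :=
  hc.mono' fun x hx => by
    by_contra h
    exact hx (partialDeriv_eq_zero_of_notMem_tsupport h i)

/-- Integration by parts against a compactly supported function. -/
theorem integral_mul_partialDeriv (ha : ContDiff ℝ 1 a) (hφ : ContDiff ℝ 1 φ)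
    (hc : HasCompactSupport φ) (i : Fin n) :
    ∫ x, a x * partialDeriv i φ x = -∫ x, partialDeriv i a x * φ x := by
  refine integral_mul_fderiv_eq_neg_fderiv_mul_of_integrable ?_ ?_ ?_
    (fun x _ => ha.differentiable (by norm_num) x) (fun x _ => hφ.differentiable (by norm_num) x)
  · exact ((continuous_partialDeriv ha i).mul hφ.continuous).integrable_of_hasCompactSupport
      hc.mul_left
  · exact (ha.continuous.mul (continuous_partialDeriv hφ i)).integrable_of_hasCompactSupport
      (hasCompactSupport_partialDeriv hc i).mul_left
  · exact (ha.continuous.mul hφ.continuous).integrable_of_hasCompactSupport hc.mul_left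

namespace IsTestFunction

theorem contDiff_one (hφ : IsTestFunction Ω φ) : ContDiff ℝ 1 φ := hφ.1.of_le (by simp)

theorem continuous (hφ : IsTestFunction Ω φ) : Continuous φ := hφ.1.continuous

theorem eq_zero (hφ : IsTestFunction Ω φ) {x : Fin n → ℝ} (hx : x ∉ Ω) : φ x = 0 :=
  image_eq_zero_of_notMem_tsupport fun h => hx (hφ.2.2 h)

theorem partialDeriv_eq_zero (hφ : IsTestFunction Ω φ) {x : Fin n → ℝ} (hx : x ∉ Ω) (i : Fin n) :
    partialDeriv i φ x = 0 :=
  partialDeriv_eq_zero_of_notMem_tsupport (fun h => hx (hφ.2.2 h)) i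

theorem differentiableAt (hφ : IsTestFunction Ω φ) (x : Fin n → ℝ) : DifferentiableAt ℝ φ x :=
  hφ.contDiff_one.differentiable (by norm_num) x

/-- The product of a test function with a function which is smooth on `Ω`. -/
theorem mul_left (hφ : IsTestFunction Ω φ) (hΩ : IsOpen Ω) (ha : ContDiffOn ℝ ∞ a Ω) :
    IsTestFunction Ω fun x => a x * φ x := by
  refine ⟨contDiff_iff_contDiffAt.2 fun x => ?_, hφ.2.1.mul_left,
    (tsupport_mul_subset_right).trans hφ.2.2⟩
  by_cases hx : x ∈ Ω
  · exact (ha.contDiffAt (hΩ.mem_nhds hx)).mul hφ.1.contDiffAt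
  · have hx' : x ∉ tsupport φ := fun h => hx (hφ.2.2 h)
    have h : φ =ᶠ[𝓝 x] fun _ => 0 := notMem_tsupport_iff_eventuallyEq.1 hx'
    refine (contDiffAt_const (c := (0:ℝ))).congr_of_eventuallyEq ?_
    filter_upwards [h] with y hy
    simp [hy]

theorem memLp (hφ : IsTestFunction Ω φ) : MemLp φ 2 (volume.restrict Ω) :=
  (hφ.continuous.memLp_of_hasCompactSupport hφ.2.1).restrict Ω

theorem memLp_partialDeriv (hφ : IsTestFunction Ω φ) (i : Fin n) :
    MemLp (partialDeriv i φ) 2 (volume.restrict Ω) :=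
  ((continuous_partialDeriv hφ.contDiff_one i).memLp_of_hasCompactSupport
    (hasCompactSupport_partialDeriv hφ.2.1 i)).restrict Ω

end IsTestFunction

end TestFunctions

/-! ### Convergence in `L²` -/

section L2

variable {α : Type*} [MeasurableSpace α] {μ : Measure α}

theorem tendsto_integral_mul_of_tendsto_eLpNorm {f g : ℕ → α → ℝ} {F G : α → ℝ}
    (hf : ∀ k, MemLp (f k) 2 μ) (hg : ∀ k, MemLp (g k) 2 μ) (hF : MemLp F 2 μ) (hG : MemLp G 2 μ)
    (hfF : Tendsto (fun k => eLpNorm (fun x => f k x - F x) 2 μ) atTop (𝓝 0))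
    (hgG : Tendsto (fun k => eLpNorm (fun x => g k x - G x) 2 μ) atTop (𝓝 0)) :
    Tendsto (fun k => ∫ x, f k x * g k x ∂μ) atTop (𝓝 (∫ x, F x * G x ∂μ)) := by
  have key : ∀ {a b : α → ℝ} (ha : MemLp a 2 μ) (hb : MemLp b 2 μ),
      inner ℝ (ha.toLp a) (hb.toLp b) = ∫ x, a x * b x ∂μ := by
    intro a b ha hb
    rw [L2.inner_def]
    refine integral_congr_ae ?_
    filter_upwards [ha.coeFn_toLp, hb.coeFn_toLp] with x h1 h2
    simp [h1, h2, mul_comm]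
  have h1 : Tendsto (fun k => (hf k).toLp (f k)) atTop (𝓝 (hF.toLp F)) :=
    (Lp.tendsto_Lp_iff_tendsto_eLpNorm'' _ hf F hF).2 hfF
  have h2 : Tendsto (fun k => (hg k).toLp (g k)) atTop (𝓝 (hG.toLp G)) :=
    (Lp.tendsto_Lp_iff_tendsto_eLpNorm'' _ hg G hG).2 hgG
  have := h1.inner (𝕜 := ℝ) h2
  simpa only [key] using this

theorem eLpNorm_two_eq_ofReal_sqrt {f : α → ℝ} (hf : MemLp f 2 μ) :
    eLpNorm f 2 μ = ENNReal.ofReal (Real.sqrt (∫ x, f x ^ 2 ∂μ)) := by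
  rw [hf.eLpNorm_eq_integral_rpow_norm (by norm_num) (by norm_num)]
  simp [Real.sqrt_eq_rpow]

theorem tendsto_eLpNorm_two_of_tendsto_integral_sq {f : ℕ → α → ℝ} (hf : ∀ k, MemLp (f k) 2 μ)
    (h : Tendsto (fun k => ∫ x, f k x ^ 2 ∂μ) atTop (𝓝 0)) :
    Tendsto (fun k => eLpNorm (f k) 2 μ) atTop (𝓝 0) := by
  simp only [fun k => eLpNorm_two_eq_ofReal_sqrt (hf k)]
  have h1 := (Real.continuous_sqrt.tendsto 0).comp h
  have h2 := (ENNReal.continuous_ofReal.tendsto _).comp h1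
  simpa [Function.comp_def] using h2

theorem tendsto_eLpNorm_two_of_bounded [IsFiniteMeasure μ] {f : ℕ → α → ℝ} {C : ℝ}
    (hf : ∀ k, AEStronglyMeasurable (f k) μ) (hC : ∀ k, ∀ᵐ x ∂μ, |f k x| ≤ C)
    (hlim : ∀ᵐ x ∂μ, Tendsto (fun k => f k x) atTop (𝓝 0)) :
    Tendsto (fun k => eLpNorm (f k) 2 μ) atTop (𝓝 0) := by
  refine tendsto_eLpNorm_two_of_tendsto_integral_sq (fun k => MemLp.of_bound (hf k) C (hC k)) ?_
  have := tendsto_integral_of_dominated_convergence (μ := μ) (F := fun k x => f k x ^ 2)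
    (f := fun _ => 0) (fun _ => C ^ 2) (fun k => (hf k).pow 2) (integrable_const _)
    (fun k => by
      filter_upwards [hC k] with x hx
      rw [Real.norm_eq_abs, abs_pow]
      exact pow_le_pow_left₀ (abs_nonneg _) hx 2)
    (by
      filter_upwards [hlim] with x hx
      simpa using hx.pow 2)
  simpa using this

end L2

/-! ### A smooth truncation of small values -/

section Cutoff

/-- A smooth function which vanishes near `0` and is the identity far from `0`. -/
noncomputable def cutoff (t : ℝ) : ℝ := t * Real.smoothTransition (t ^ 2 - 1)

theorem contDiff_cutoff : ContDiff ℝ ∞ cutoff := by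
  unfold cutoff
  exact contDiff_id.mul (Real.smoothTransition.contDiff.comp (by fun_prop))

theorem cutoff_eq_zero {t : ℝ} (ht : |t| ≤ 1) : cutoff t = 0 := by
  rw [cutoff, Real.smoothTransition.zero_of_nonpos, mul_zero]
  have := (sq_le_one_iff_abs_le_one t).2 ht
  linarith

theorem cutoff_eq_self {t : ℝ} (ht : 2 ≤ |t|) : cutoff t = t := by
  rw [cutoff, Real.smoothTransition.one_of_one_le, mul_one]
  rw [← sq_abs]; nlinarith

theorem abs_cutoff_le (t : ℝ) : |cutoff t| ≤ |t| := by
  rw [cutoff, abs_mul, abs_of_nonneg (Real.smoothTransition.nonneg _)]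
  exact mul_le_of_le_one_right (abs_nonneg _) (Real.smoothTransition.le_one _)

theorem deriv_cutoff_eq_one {t : ℝ} (ht : 2 < |t|) : deriv cutoff t = 1 := by
  have h : cutoff =ᶠ[𝓝 t] id := by
    filter_upwards [(isOpen_lt continuous_const continuous_abs).mem_nhds ht] with s hs
    exact cutoff_eq_self hs.le
  rw [h.deriv_eq]; simp

theorem exists_abs_deriv_cutoff_le : ∃ C, ∀ t, |deriv cutoff t| ≤ C := by
  have hc : Continuous (deriv cutoff) := contDiff_cutoff.continuous_deriv (by simp)
  obtain ⟨C, hC⟩ := isCompact_Icc.exists_bound_of_continuousOn (s := Icc (-2:ℝ) 2) hc.continuousOn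
  refine ⟨max C 1, fun t => ?_⟩
  rcases le_or_gt |t| 2 with h | h
  · exact (hC t (abs_le.1 h)).trans (le_max_left _ _)
  · rw [deriv_cutoff_eq_one h]; simp

end Cutoff

/-! ### Nodeless solutions are Dirichlet eigenfunctions -/

/-- A classical solution of `-Δu + V u = Λ u` in a bounded convex open set, which vanishes on the
boundary but not inside. -/
structure IsNodelessSolution {n : ℕ} (Ω : Set (Fin n → ℝ)) (V : (Fin n → ℝ) → ℝ) (Λ : ℝ)
    (u : (Fin n → ℝ) → ℝ) : Prop where
  isOpen : IsOpen Ω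
  bounded : Bornology.IsBounded Ω
  convex : Convex ℝ Ω
  nonempty : Ω.Nonempty
  continuous_potential : Continuous V
  contDiff : ContDiff ℝ 2 u
  smooth : ContDiffOn ℝ ∞ u Ω
  ne_zero : ∀ x ∈ Ω, u x ≠ 0
  frontier : ∀ x ∈ frontier Ω, u x = 0
  pde : ∀ x ∈ Ω, ∑ i, partialDeriv i (partialDeriv i u) x = (V x - Λ) * u x

namespace IsNodelessSolution

variable {n : ℕ} {Ω : Set (Fin n → ℝ)} {V : (Fin n → ℝ) → ℝ} {Λ : ℝ} {u : (Fin n → ℝ) → ℝ}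

theorem isFiniteMeasure (h : IsNodelessSolution Ω V Λ u) :
    IsFiniteMeasure (volume.restrict Ω) :=
  ⟨by simpa using h.bounded.measure_lt_top⟩

theorem exists_bound (h : IsNodelessSolution Ω V Λ u) {f : (Fin n → ℝ) → ℝ} (hf : Continuous f) :
    ∃ C, ∀ x ∈ Ω, |f x| ≤ C := by
  obtain ⟨C, hC⟩ := h.bounded.isCompact_closure.exists_bound_of_continuousOn hf.continuousOn
  exact ⟨C, fun x hx => hC x (subset_closure hx)⟩

theorem memLp (h : IsNodelessSolution Ω V Λ u) {f : (Fin n → ℝ) → ℝ} (hf : Continuous f) :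
    MemLp f 2 (volume.restrict Ω) := by
  have := h.isFiniteMeasure
  obtain ⟨C, hC⟩ := h.exists_bound hf
  exact MemLp.of_bound hf.aestronglyMeasurable C
    ((ae_restrict_iff' h.isOpen.measurableSet).2 (ae_of_all _ hC))

theorem contDiff_one (h : IsNodelessSolution Ω V Λ u) : ContDiff ℝ 1 u :=
  h.contDiff.of_le (by norm_num)

theorem contDiff_partialDeriv (h : IsNodelessSolution Ω V Λ u) (i : Fin n) :
    ContDiff ℝ 1 (partialDeriv i u) :=
  (h.contDiff.fderiv_right (m := 1) (by norm_num [one_add_one_eq_two])).clm_apply contDiff_const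

theorem differentiableAt (h : IsNodelessSolution Ω V Λ u) (x : Fin n → ℝ) :
    DifferentiableAt ℝ u x := h.contDiff_one.differentiable (by norm_num) x

/-- The support lies in the set of points of `closure Ω` where `|u| ≥ 1 / (k + 1)`. This set is
compact and avoids the boundary, where `u = 0`. -/
theorem isTestFunction_cutoff (h : IsNodelessSolution Ω V Λ u) (k : ℕ) :
    IsTestFunction Ω (Ω.indicator fun x => cutoff ((k + 1) * u x) / (k + 1)) := by
  set f : (Fin n → ℝ) → ℝ := fun x => cutoff ((k + 1) * u x) / (k + 1) with hf
  set K : Set (Fin n → ℝ) := closure Ω ∩ {x | 1 ≤ |(k + 1) * u x|} with hK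
  have hKc : IsCompact K := h.bounded.isCompact_closure.inter_right
    (isClosed_le continuous_const (by have := h.contDiff.continuous; fun_prop))
  have hKΩ : K ⊆ Ω := by
    rintro x ⟨hx1, hx2⟩
    by_contra hx
    have h1 : x ∈ _root_.frontier Ω := ⟨hx1, by rwa [h.isOpen.interior_eq]⟩
    simp only [mem_ofPred_eq, h.frontier x h1, mul_zero, abs_zero] at hx2
    linarith
  have hsupp : Function.support (Ω.indicator f) ⊆ K := by
    intro x hx
    have hxΩ : x ∈ Ω := by
      by_contra hne
      exact hx (indicator_of_notMem hne f)
    refine ⟨subset_closure hxΩ, ?_⟩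
    by_contra hlt
    simp only [mem_ofPred_eq, not_le] at hlt
    apply hx
    rw [indicator_of_mem hxΩ, hf]
    simp only [cutoff_eq_zero hlt.le, zero_div]
  have hts : tsupport (Ω.indicator f) ⊆ K := closure_minimal hsupp hKc.isClosed
  refine ⟨contDiff_iff_contDiffAt.2 fun x => ?_, HasCompactSupport.of_support_subset_isCompact hKc
    hsupp, hts.trans hKΩ⟩
  by_cases hx : x ∈ Ω
  · have h1 : ContDiffAt ℝ ∞ f x := by
      have hu := h.smooth.contDiffAt (h.isOpen.mem_nhds hx)
      exact (contDiff_cutoff.contDiffAt.comp x (contDiffAt_const.mul hu)).div_const _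
    refine h1.congr_of_eventuallyEq ?_
    filter_upwards [h.isOpen.mem_nhds hx] with y hy
    exact indicator_of_mem hy f
  · have hx' : x ∉ tsupport (Ω.indicator f) := fun h => hx (hKΩ (hts h))
    exact (contDiffAt_const (c := (0:ℝ))).congr_of_eventuallyEq
      (notMem_tsupport_iff_eventuallyEq.1 hx')

theorem partialDeriv_cutoff (h : IsNodelessSolution Ω V Λ u) (k : ℕ) (i : Fin n)
    {x : Fin n → ℝ} (hx : x ∈ Ω) :
    partialDeriv i (Ω.indicator fun x => cutoff ((k + 1) * u x) / (k + 1)) x =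
      deriv cutoff ((k + 1) * u x) * partialDeriv i u x := by
  have h0 : ((k:ℝ) + 1) ≠ 0 := by positivity
  have h1 : (Ω.indicator fun x => cutoff ((k + 1) * u x) / (k + 1)) =ᶠ[𝓝 x]
      fun x => cutoff ((k + 1) * u x) / (k + 1) := by
    filter_upwards [h.isOpen.mem_nhds hx] with y hy
    exact indicator_of_mem hy _
  have hd : HasDerivAt cutoff (deriv cutoff ((k + 1) * u x)) ((k + 1) * u x) :=
    (contDiff_cutoff.differentiable (by simp) _).hasDerivAt
  have h3 : HasFDerivAt (fun x => cutoff ((k + 1) * u x) / (k + 1))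
      (((k:ℝ) + 1)⁻¹ • (deriv cutoff ((k + 1) * u x) • (((k:ℝ) + 1) • fderiv ℝ u x))) x := by
    simp only [div_eq_mul_inv]
    exact (hd.comp_hasFDerivAt x
      ((h.differentiableAt x).hasFDerivAt.const_mul ((k:ℝ) + 1))).mul_const (((k:ℝ) + 1)⁻¹)
  rw [partialDeriv, h1.fderiv_eq, h3.fderiv]
  simp only [smul_apply, smul_eq_mul, partialDeriv]
  field_simp

/-- The truncations and their gradients are bounded uniformly in `k`. At each point of `Ω`, since `u
≠ 0` there, they agree with `u` and its gradient from some `k` on; dominated convergence concludes.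
-/
theorem hasH01Gradient (h : IsNodelessSolution Ω V Λ u) :
    HasH01Gradient Ω u fun i => partialDeriv i u := by
  have := h.isFiniteMeasure
  have hae : ∀ {p : (Fin n → ℝ) → Prop}, (∀ x ∈ Ω, p x) → ∀ᵐ x ∂volume.restrict Ω, p x :=
    fun hp => (ae_restrict_iff' h.isOpen.measurableSet).2 (ae_of_all _ hp)
  have hcu := h.contDiff.continuous
  have hbig : ∀ x ∈ Ω, ∀ᶠ k : ℕ in atTop, 2 < |((k:ℝ) + 1) * u x| := by
    intro x hx
    have h1 : Tendsto (fun k : ℕ => ((k:ℝ) + 1) * |u x|) atTop atTop :=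
      (tendsto_atTop_add_const_right _ _ tendsto_natCast_atTop_atTop).atTop_mul_const
        (abs_pos.2 (h.ne_zero x hx))
    filter_upwards [h1.eventually_gt_atTop 2] with k hk
    rwa [abs_mul, abs_of_pos (by positivity : (0:ℝ) < (k:ℝ) + 1)]
  refine ⟨h.memLp hcu, fun i => h.memLp (h.contDiff_partialDeriv i).continuous,
    fun k => Ω.indicator fun x => cutoff ((k + 1) * u x) / (k + 1), h.isTestFunction_cutoff,
    ?_, fun i => ?_⟩
  · obtain ⟨C, hC⟩ := h.exists_bound hcu
    refine tendsto_eLpNorm_two_of_bounded (C := C + C)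
      (fun k => ((h.isTestFunction_cutoff k).continuous.sub hcu).aestronglyMeasurable)
      (fun k => hae fun x hx => ?_) (hae fun x hx => ?_)
    · dsimp only
      rw [indicator_of_mem hx]
      refine (abs_sub _ _).trans (add_le_add ?_ (hC x hx))
      rw [abs_div, abs_of_pos (by positivity : (0:ℝ) < (k:ℝ) + 1), div_le_iff₀ (by positivity)]
      refine (abs_cutoff_le _).trans ?_
      rw [abs_mul, abs_of_pos (by positivity : (0:ℝ) < (k:ℝ) + 1), mul_comm]
      exact mul_le_mul_of_nonneg_right (hC x hx) (by positivity)
    · refine tendsto_const_nhds.congr' ?_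
      filter_upwards [hbig x hx] with k hk
      have h0 : ((k:ℝ) + 1) ≠ 0 := by positivity
      rw [indicator_of_mem hx, cutoff_eq_self hk.le]
      field_simp
      ring
  · obtain ⟨C, hC⟩ := h.exists_bound (h.contDiff_partialDeriv i).continuous
    obtain ⟨D, hD⟩ := exists_abs_deriv_cutoff_le
    refine tendsto_eLpNorm_two_of_bounded (C := D * C + C)
      (fun k => ((continuous_partialDeriv (h.isTestFunction_cutoff k).contDiff_one i).sub
        (h.contDiff_partialDeriv i).continuous).aestronglyMeasurable)
      (fun k => hae fun x hx => ?_) (hae fun x hx => ?_)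
    · rw [h.partialDeriv_cutoff k i hx]
      refine (abs_sub _ _).trans (add_le_add ?_ (hC x hx))
      rw [abs_mul]
      exact mul_le_mul (hD _) (hC x hx) (abs_nonneg _) ((abs_nonneg _).trans (hD 0))
    · refine tendsto_const_nhds.congr' ?_
      filter_upwards [hbig x hx] with k hk
      rw [h.partialDeriv_cutoff k i hx, deriv_cutoff_eq_one hk]
      ring

theorem weak_form (h : IsNodelessSolution Ω V Λ u) {φ : (Fin n → ℝ) → ℝ}
    (hφ : IsTestFunction Ω φ) :
    ∫ x in Ω, ((∑ i, partialDeriv i u x * partialDeriv i φ x) + V x * u x * φ x) =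
      Λ * ∫ x in Ω, u x * φ x := by
  have hcu := h.contDiff.continuous
  have hcV := h.continuous_potential
  have hcd := fun i => (h.contDiff_partialDeriv i).continuous
  rw [setIntegral_eq_integral_of_forall_compl_eq_zero (fun x hx => by
      simp [hφ.eq_zero hx, hφ.partialDeriv_eq_zero hx]),
    setIntegral_eq_integral_of_forall_compl_eq_zero (fun x hx => by simp [hφ.eq_zero hx])]
  have hi1 : ∀ i, Integrable fun x => partialDeriv i u x * partialDeriv i φ x := fun i =>
    ((hcd i).mul (continuous_partialDeriv hφ.contDiff_one i)).integrable_of_hasCompactSupport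
      (hasCompactSupport_partialDeriv hφ.2.1 i).mul_left
  have hi2 : Integrable fun x => V x * u x * φ x :=
    ((hcV.mul hcu).mul hφ.continuous).integrable_of_hasCompactSupport hφ.2.1.mul_left
  have hi3 : ∀ i, Integrable fun x => partialDeriv i (partialDeriv i u) x * φ x := fun i =>
    ((continuous_partialDeriv (h.contDiff_partialDeriv i) i).mul
      hφ.continuous).integrable_of_hasCompactSupport hφ.2.1.mul_left
  rw [integral_add (integrable_finsetSum _ fun i _ => hi1 i) hi2,
    integral_finsetSum _ fun i _ => hi1 i]
  simp only [fun i => integral_mul_partialDeriv (h.contDiff_partialDeriv i) hφ.contDiff_one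
    hφ.2.1 i]
  rw [Finset.sum_neg_distrib, ← integral_finsetSum _ fun i _ => hi3 i, neg_add_eq_sub,
    ← integral_sub hi2 (integrable_finsetSum _ fun i _ => hi3 i), ← integral_const_mul]
  refine integral_congr_ae (ae_of_all _ fun x => ?_)
  simp only [← Finset.sum_mul]
  by_cases hx : x ∈ Ω
  · rw [h.pde x hx]; ring
  · simp [hφ.eq_zero hx]

theorem isDirichletEigenfunction (h : IsNodelessSolution Ω V Λ u) :
    IsDirichletEigenfunction Ω V Λ u := by
  refine ⟨fun h0 => ?_, _, h.hasH01Gradient, fun φ hφ => h.weak_form hφ⟩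
  have h1 : ∀ᵐ x ∂volume.restrict Ω, False := by
    filter_upwards [h0, ae_restrict_mem h.isOpen.measurableSet] with x hx hxΩ
    exact h.ne_zero x hxΩ hx
  simp only [eventually_false_iff_eq_bot, ae_eq_bot, Measure.restrict_eq_zero] at h1
  exact (h.isOpen.measure_pos volume h.nonempty).ne' h1

end IsNodelessSolution

/-! ### Functions with vanishing weak gradient -/

section WeakGradient

open scoped Convolution

variable {n : ℕ}

/-- The points at distance at least `ε` from the complement of `Ω`. -/
def innerPart (Ω : Set (Fin n → ℝ)) (ε : ℝ) : Set (Fin n → ℝ) :=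
  {x | ENNReal.ofReal ε ≤ Metric.infEDist x Ωᶜ}

theorem innerPart_subset {Ω : Set (Fin n → ℝ)} {ε : ℝ} (hε : 0 < ε) : innerPart Ω ε ⊆ Ω := by
  intro x hx
  by_contra h
  have h1 : Metric.infEDist x Ωᶜ = 0 := Metric.infEDist_zero_of_mem h
  have h2 : ENNReal.ofReal ε ≤ Metric.infEDist x Ωᶜ := hx
  rw [h1, nonpos_iff_eq_zero, ENNReal.ofReal_eq_zero] at h2
  linarith

theorem isCompact_innerPart {Ω : Set (Fin n → ℝ)} (hb : Bornology.IsBounded Ω) {ε : ℝ}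
    (hε : 0 < ε) : IsCompact (innerPart Ω ε) :=
  Metric.isCompact_of_isClosed_isBounded
    (isClosed_le continuous_const Metric.continuous_infEDist) (hb.subset (innerPart_subset hε))

theorem mem_innerPart_of_ball_subset {Ω : Set (Fin n → ℝ)} {x : Fin n → ℝ} {ε : ℝ}
    (h : Metric.ball x ε ⊆ Ω) : x ∈ innerPart Ω ε := by
  refine Metric.le_infEDist.2 fun y hy => ?_
  by_contra! hlt
  refine hy (h ?_)
  rw [edist_dist] at hlt
  rw [Metric.mem_ball, dist_comm]
  exact (ENNReal.ofReal_lt_ofReal_iff_of_nonneg dist_nonneg).1 hlt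

/-- The mollification of a function whose weak gradient vanishes has derivative zero. -/
theorem hasFDerivAt_convolution_zero {Ω : Set (Fin n → ℝ)} {w W : (Fin n → ℝ) → ℝ}
    (h0 : ∀ ζ, IsTestFunction Ω ζ → ∀ i, ∫ x in Ω, w x * partialDeriv i ζ x = 0)
    (hW : LocallyIntegrable W) {ρ : (Fin n → ℝ) → ℝ} (hρ : ContDiff ℝ ∞ ρ)
    (hc : HasCompactSupport ρ) {z : Fin n → ℝ}
    (hz : ∀ s, z - s ∈ tsupport ρ → s ∈ Ω ∧ W s = w s) :
    HasFDerivAt (ρ ⋆[ContinuousLinearMap.lsmul ℝ ℝ, volume] W)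
      (0 : (Fin n → ℝ) →L[ℝ] ℝ) z := by
  have hρ1 : ContDiff ℝ 1 ρ := hρ.of_le (by simp)
  have h1 := hc.hasFDerivAt_convolution_left (ContinuousLinearMap.lsmul ℝ ℝ) hρ1 hW z
  have hex := (hc.fderiv ℝ).convolutionExists_left
    ((ContinuousLinearMap.lsmul ℝ ℝ : ℝ →L[ℝ] ℝ →L[ℝ] ℝ).precompL (Fin n → ℝ))
    (hρ1.continuous_fderiv (by norm_num)) hW z
  have key : ∀ i : Fin n, (fderiv ℝ ρ ⋆[(ContinuousLinearMap.lsmul ℝ ℝ).precompL (Fin n → ℝ),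
      volume] W) z (Pi.single i 1) = 0 := by
    intro i
    rw [convolution, ContinuousLinearMap.integral_apply hex]
    simp only [ContinuousLinearMap.precompL_apply, ContinuousLinearMap.lsmul_apply, smul_eq_mul]
    -- After the reflection `s ↦ z - s` the integrand is, up to sign, `W` times a partial derivative
    -- of the test function `ρ (z - ·)`.
    rw [← integral_sub_left_eq_self _ volume z]
    simp only [sub_sub_cancel]
    set ζ : (Fin n → ℝ) → ℝ := fun s => ρ (z - s) with hζ
    have hsub : ContDiff ℝ ∞ fun s : Fin n → ℝ => z - s := contDiff_const.sub contDiff_id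
    have hζc : HasCompactSupport ζ := hc.comp_homeomorph (Homeomorph.subLeft z)
    have hζs : tsupport ζ ⊆ (fun s => z - s) ⁻¹' tsupport ρ :=
      closure_minimal (fun s hs => subset_tsupport ρ hs)
        ((isClosed_tsupport ρ).preimage hsub.continuous)
    have hζt : IsTestFunction Ω ζ := ⟨hρ.comp hsub, hζc, fun s hs => (hz s (hζs hs)).1⟩
    have hder : ∀ s, partialDeriv i ζ s = -(fderiv ℝ ρ (z - s) (Pi.single i 1)) := by
      intro s
      have h2 : HasFDerivAt (fun s : Fin n → ℝ => z - s)
          (-ContinuousLinearMap.id ℝ (Fin n → ℝ)) s := by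
        exact (hasFDerivAt_id (𝕜 := ℝ) s).const_sub z
      have h3 := ((hρ1.differentiable (by norm_num) (z - s)).hasFDerivAt).comp s h2
      have h4 : fderiv ℝ ζ s = (fderiv ℝ ρ (z - s)).comp (-ContinuousLinearMap.id ℝ (Fin n → ℝ)) :=
        h3.fderiv
      rw [partialDeriv, h4]
      simp
    have h5 := h0 ζ hζt i
    rw [setIntegral_eq_integral_of_forall_compl_eq_zero (fun x hx => by
      simp [hζt.partialDeriv_eq_zero hx])] at h5
    rw [← neg_eq_zero, ← integral_neg, ← h5]
    refine integral_congr_ae (ae_of_all _ fun s => ?_)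
    by_cases hs : z - s ∈ tsupport ρ
    · simp only [hder, (hz s hs).2]; ring
    · have h6 : fderiv ℝ ρ (z - s) (Pi.single i 1) = 0 :=
        partialDeriv_eq_zero_of_notMem_tsupport hs i
      simp [hder, h6]
  have hD : (fderiv ℝ ρ ⋆[(ContinuousLinearMap.lsmul ℝ ℝ).precompL (Fin n → ℝ), volume] W) z =
      0 := by
    refine ContinuousLinearMap.coe_injective ((Pi.basisFun ℝ (Fin n)).ext fun i => ?_)
    simpa using key i
  rwa [hD] at h1

/-- A locally integrable function with zero weak gradient on a bounded convex open set is
constant. -/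
theorem ae_eq_const_of_weak_gradient_eq_zero {Ω : Set (Fin n → ℝ)} (hΩ : IsOpen Ω)
    (hb : Bornology.IsBounded Ω) (hconv : Convex ℝ Ω) {w : (Fin n → ℝ) → ℝ}
    (hw : ∀ K ⊆ Ω, IsCompact K → IntegrableOn w K)
    (h0 : ∀ ζ, IsTestFunction Ω ζ → ∀ i, ∫ x in Ω, w x * partialDeriv i ζ x = 0) :
    ∃ C : ℝ, w =ᵐ[volume.restrict Ω] fun _ => C := by
  have hpos : ∀ m : ℕ, (0:ℝ) < 1 / ((m:ℝ) + 1) := fun m => by positivity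
  set K : ℕ → Set (Fin n → ℝ) := fun m => innerPart Ω (1 / ((m:ℝ) + 1)) with hK
  have hKc : ∀ m, IsCompact (K m) := fun m => isCompact_innerPart hb (hpos m)
  -- `w` is only known to be integrable on compact subsets of `Ω`; cutting it off to `K m` allows it
  -- to be mollified on the whole space.
  set W : ℕ → (Fin n → ℝ) → ℝ := fun m => (K m).indicator w with hWdef
  have hW : ∀ m, LocallyIntegrable (W m) := fun m =>
    ((integrable_indicator_iff (hKc m).measurableSet).2
      (hw _ (innerPart_subset (hpos m)) (hKc m))).locallyIntegrable
  let ρ : ℕ → ContDiffBump (0 : Fin n → ℝ) := fun j =>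
    ⟨1 / ((j:ℝ) + 1) / 2, 1 / ((j:ℝ) + 1), half_pos (hpos j), half_lt_self (hpos j)⟩
  have hρ0 : Tendsto (fun j => (ρ j).rOut) atTop (𝓝 0) := tendsto_one_div_add_atTop_nhds_zero_nat
  have hae : ∀ᵐ x : Fin n → ℝ, ∀ m, Tendsto (fun j =>
      ((ρ j).normed volume ⋆[ContinuousLinearMap.lsmul ℝ ℝ, volume] W m) x) atTop
      (𝓝 (W m x)) := by
    rw [ae_all_iff]
    intro m
    refine ContDiffBump.ae_convolution_tendsto_right_of_locallyIntegrable (K := 2) hρ0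
      (Eventually.of_forall fun j => ?_) (hW m)
    change 1 / ((j:ℝ) + 1) ≤ 2 * (1 / ((j:ℝ) + 1) / 2)
    linarith
  -- At two points where the mollifications converge, the values agree: near the segment joining
  -- them, which lies in the convex set `Ω`, fine mollifications have zero derivative.
  have hpair : ∀ x ∈ Ω, ∀ y ∈ Ω,
      (∀ m, Tendsto (fun j =>
        ((ρ j).normed volume ⋆[ContinuousLinearMap.lsmul ℝ ℝ, volume] W m) x) atTop
        (𝓝 (W m x))) →
      (∀ m, Tendsto (fun j =>
        ((ρ j).normed volume ⋆[ContinuousLinearMap.lsmul ℝ ℝ, volume] W m) y) atTop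
        (𝓝 (W m y))) → w y = w x := by
    intro x hx y hy hxl hyl
    have hSc : IsCompact (segment ℝ x y) := by
      rw [segment_eq_image_lineMap]
      exact isCompact_Icc.image (AffineMap.lineMap_continuous)
    obtain ⟨δ, hδ, hδΩ⟩ := hSc.exists_thickening_subset_open hΩ (hconv.segment_subset hx hy)
    -- Three errors have to fit into `δ`: from the segment to `z`, from `z` to `s`, and from `s` to
    -- a point of the ball that puts `s` in `K m`.
    set ε := δ / 3 with hε
    have hε0 : 0 < ε := by positivity
    set T := Metric.thickening ε (segment ℝ x y) with hT
    have hTx : x ∈ T := Metric.self_subset_thickening hε0 _ (left_mem_segment ℝ x y)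
    have hTy : y ∈ T := Metric.self_subset_thickening hε0 _ (right_mem_segment ℝ x y)
    obtain ⟨m, hm⟩ := exists_nat_one_div_lt hε0
    have hin : ∀ z ∈ T, ∀ s, dist s z ≤ ε → s ∈ K m := by
      intro z hz s hs
      refine mem_innerPart_of_ball_subset fun t ht => hδΩ ?_
      obtain ⟨p, hp, hpz⟩ := Metric.mem_thickening_iff.1 hz
      refine Metric.mem_thickening_iff.2 ⟨p, hp, ?_⟩
      have h1 := dist_triangle4 t s z p
      have h2 : dist t s < 1 / ((m:ℝ) + 1) := ht
      linarith
    have heq : ∀ᶠ j in atTop,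
        ((ρ j).normed volume ⋆[ContinuousLinearMap.lsmul ℝ ℝ, volume] W m) y =
        ((ρ j).normed volume ⋆[ContinuousLinearMap.lsmul ℝ ℝ, volume] W m) x := by
      filter_upwards [hρ0.eventually_lt_const hε0] with j hj
      have hd : ∀ z ∈ T, HasFDerivAt
          ((ρ j).normed volume ⋆[ContinuousLinearMap.lsmul ℝ ℝ, volume] W m)
          (0 : (Fin n → ℝ) →L[ℝ] ℝ) z := by
        intro z hz
        refine hasFDerivAt_convolution_zero h0 (hW m) (ρ j).contDiff_normed
          (ρ j).hasCompactSupport_normed fun s hs => ?_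
        rw [(ρ j).tsupport_normed_eq, mem_closedBall_zero_iff, ← dist_eq_norm, dist_comm] at hs
        have hsK := hin z hz s (hs.trans hj.le)
        exact ⟨innerPart_subset (hpos m) hsK, indicator_of_mem hsK w⟩
      exact Metric.isOpen_thickening.is_const_of_fderiv_eq_zero
        ((convex_segment x y).thickening ε).isPreconnected
        (fun z hz => (hd z hz).differentiableAt.differentiableWithinAt)
        (fun z hz => (hd z hz).fderiv) hTy hTx
    have h1 := tendsto_nhds_unique ((hyl m).congr' heq) (hxl m)
    simp only [hWdef] at h1
    rwa [indicator_of_mem (hin y hTy y (by simpa using hε0.le)),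
      indicator_of_mem (hin x hTx x (by simpa using hε0.le))] at h1
  have hae' := ae_restrict_of_ae (s := Ω) hae
  rcases eq_or_ne (volume.restrict Ω) 0 with hz | hz
  · exact ⟨0, by rw [hz]; exact ae_zero.symm ▸ trivial⟩
  · have : NeBot (ae (volume.restrict Ω)) := ae_neBot.2 hz
    obtain ⟨x, hxl, hx⟩ := (hae'.and (ae_restrict_mem hΩ.measurableSet)).exists
    refine ⟨w x, ?_⟩
    filter_upwards [hae', ae_restrict_mem hΩ.measurableSet] with y hyl hy
    exact hpair x hx y hy hxl hyl

end WeakGradient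

/-! ### Jacobi's identity and the ground state -/

namespace IsNodelessSolution

variable {n : ℕ} {Ω : Set (Fin n → ℝ)} {V : (Fin n → ℝ) → ℝ} {Λ : ℝ} {u : (Fin n → ℝ) → ℝ}

/-- Jacobi's identity. -/
theorem energy_mul (h : IsNodelessSolution Ω V Λ u) {ψ : (Fin n → ℝ) → ℝ}
    (hψ : IsTestFunction Ω ψ) :
    (∑ i, ∫ x in Ω, partialDeriv i (fun x => u x * ψ x) x * partialDeriv i (fun x => u x * ψ x) x) +
      ∫ x in Ω, V x * (u x * ψ x) * (u x * ψ x) =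
    Λ * (∫ x in Ω, (u x * ψ x) * (u x * ψ x)) +
      ∑ i, ∫ x in Ω, (u x * partialDeriv i ψ x) * (u x * partialDeriv i ψ x) := by
  have hφ : IsTestFunction Ω fun x => u x * ψ x := hψ.mul_left h.isOpen h.smooth
  have hχ : IsTestFunction Ω fun x => ψ x * (u x * ψ x) :=
    hφ.mul_left h.isOpen hψ.1.contDiffOn
  -- The equation for `u` is tested with `u ψ²`; the pointwise identity `|∇(uψ)|² = ∇u · ∇(uψ²) + u²
  -- |∇ψ|²` then does the rest.
  have hw := h.weak_form hχ
  have hcu := h.contDiff.continuous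
  have hcV := h.continuous_potential
  have hcd := fun i => (h.contDiff_partialDeriv i).continuous
  have hcψ := fun i => continuous_partialDeriv hψ.contDiff_one i
  have hcχ := fun i => continuous_partialDeriv hχ.contDiff_one i
  have hint : ∀ {f g : (Fin n → ℝ) → ℝ}, Continuous f → Continuous g →
      Integrable (fun x => f x * g x) (volume.restrict Ω) := fun hf hg =>
    (h.memLp hf).integrable_mul (h.memLp hg)
  have hi1 := fun i => hint (hcd i) (hcχ i)
  have hi2 : Integrable (fun x => V x * u x * (ψ x * (u x * ψ x))) (volume.restrict Ω) :=
    hint (hcV.mul hcu) hχ.continuous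
  rw [integral_add (integrable_finsetSum _ fun i _ => hi1 i) hi2,
    integral_finsetSum _ fun i _ => hi1 i] at hw
  have e1 : ∀ x, V x * u x * (ψ x * (u x * ψ x)) = V x * (u x * ψ x) * (u x * ψ x) :=
    fun x => by ring
  have e2 : ∀ x, u x * (ψ x * (u x * ψ x)) = (u x * ψ x) * (u x * ψ x) := fun x => by ring
  simp only [e1, e2] at hw
  have e3 : ∀ i, ∫ x in Ω, partialDeriv i (fun x => u x * ψ x) x *
      partialDeriv i (fun x => u x * ψ x) x =
      (∫ x in Ω, partialDeriv i u x * partialDeriv i (fun x => ψ x * (u x * ψ x)) x) +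
      ∫ x in Ω, (u x * partialDeriv i ψ x) * (u x * partialDeriv i ψ x) := by
    intro i
    have hi3 : Integrable (fun x => (u x * partialDeriv i ψ x) * (u x * partialDeriv i ψ x))
      (volume.restrict Ω) := hint (hcu.mul (hcψ i)) (hcu.mul (hcψ i))
    rw [← integral_add (hi1 i) hi3]
    refine integral_congr_ae (ae_of_all _ fun x => ?_)
    dsimp only
    rw [partialDeriv_mul (hψ.differentiableAt x) (hφ.differentiableAt x),
      partialDeriv_mul (h.differentiableAt x) (hψ.differentiableAt x)]
    ring
  simp only [e3, Finset.sum_add_distrib]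
  linarith

theorem memLp_potential_mul (h : IsNodelessSolution Ω V Λ u) {f : (Fin n → ℝ) → ℝ}
    (hf : MemLp f 2 (volume.restrict Ω)) :
    MemLp (fun x => V x * f x) 2 (volume.restrict Ω) := by
  obtain ⟨C, hC⟩ := h.exists_bound h.continuous_potential
  refine hf.of_le_mul (c := C)
    (h.continuous_potential.aestronglyMeasurable.mul hf.aestronglyMeasurable)
    ((ae_restrict_iff' h.isOpen.measurableSet).2 (ae_of_all _ fun x hx => ?_))
  rw [norm_mul]
  exact mul_le_mul_of_nonneg_right (hC x hx) (norm_nonneg _)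

theorem tendsto_potential_mul (h : IsNodelessSolution Ω V Λ u) {f : ℕ → (Fin n → ℝ) → ℝ}
    {F : (Fin n → ℝ) → ℝ}
    (hf : Tendsto (fun k => eLpNorm (fun x => f k x - F x) 2 (volume.restrict Ω)) atTop (𝓝 0)) :
    Tendsto (fun k => eLpNorm (fun x => V x * f k x - V x * F x) 2 (volume.restrict Ω)) atTop
      (𝓝 0) := by
  obtain ⟨C, hC⟩ := h.exists_bound h.continuous_potential
  have h1 := ENNReal.Tendsto.const_mul hf (a := ENNReal.ofReal C) (Or.inr ENNReal.ofReal_ne_top)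
  rw [mul_zero] at h1
  refine tendsto_of_tendsto_of_tendsto_of_le_of_le tendsto_const_nhds h1 (fun _ => zero_le)
    fun k => ?_
  refine eLpNorm_le_mul_eLpNorm_of_ae_le_mul
    ((ae_restrict_iff' h.isOpen.measurableSet).2 (ae_of_all _ fun x hx => ?_)) 2
  rw [← mul_sub, norm_mul]
  exact mul_le_mul_of_nonneg_right (hC x hx) (norm_nonneg _)

theorem isTestFunction_inv_mul (h : IsNodelessSolution Ω V Λ u) {φ : (Fin n → ℝ) → ℝ}
    (hφ : IsTestFunction Ω φ) : IsTestFunction Ω fun x => (u x)⁻¹ * φ x :=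
  hφ.mul_left h.isOpen (h.smooth.inv h.ne_zero)

theorem mul_inv_mul (h : IsNodelessSolution Ω V Λ u) {φ : (Fin n → ℝ) → ℝ}
    (hφ : IsTestFunction Ω φ) (x : Fin n → ℝ) : u x * ((u x)⁻¹ * φ x) = φ x := by
  by_cases hx : x ∈ Ω
  · rw [mul_inv_cancel_left₀ (h.ne_zero x hx)]
  · simp [hφ.eq_zero hx]

/-- For an eigenfunction `v = lim φ k` with eigenvalue `ν`, the Jacobi energies of the `φ k`
converge to `(ν - Λ) ‖v‖²`. -/
theorem tendsto_energy (h : IsNodelessSolution Ω V Λ u) {ν : ℝ} {v : (Fin n → ℝ) → ℝ}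
    {g : Fin n → (Fin n → ℝ) → ℝ} (hv : MemLp v 2 (volume.restrict Ω))
    (hg : ∀ i, MemLp (g i) 2 (volume.restrict Ω))
    (hweak : ∀ φ : (Fin n → ℝ) → ℝ, IsTestFunction Ω φ →
        ∫ x in Ω, ((∑ i, g i x * partialDeriv i φ x) + V x * v x * φ x) =
          ν * ∫ x in Ω, v x * φ x)
    {φ : ℕ → (Fin n → ℝ) → ℝ} (hφ : ∀ k, IsTestFunction Ω (φ k))
    (hφv : Tendsto (fun k => eLpNorm (fun x => φ k x - v x) 2 (volume.restrict Ω)) atTop (𝓝 0))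
    (hφg : ∀ i, Tendsto (fun k => eLpNorm (fun x => partialDeriv i (φ k) x - g i x) 2
        (volume.restrict Ω)) atTop (𝓝 0)) :
    Tendsto (fun k => ∑ i, ∫ x in Ω, (u x * partialDeriv i (fun x => (u x)⁻¹ * φ k x) x) *
      (u x * partialDeriv i (fun x => (u x)⁻¹ * φ k x) x)) atTop
      (𝓝 ((ν - Λ) * ∫ x in Ω, v x * v x)) := by
  have hVv := h.memLp_potential_mul hv
  have hconst : ∀ f : (Fin n → ℝ) → ℝ,
      Tendsto (fun _ : ℕ => eLpNorm (fun x => f x - f x) 2 (volume.restrict Ω)) atTop (𝓝 0) := by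
    intro f
    simp only [sub_self, eLpNorm_zero']
    exact tendsto_const_nhds
  have hφm := fun k => (hφ k).memLp
  have hφd := fun i k => (hφ k).memLp_partialDeriv i
  -- The weak equation for `v` is tested with `φ k`; in the limit `v` is tested with itself.
  have hlimit : (∑ i, ∫ x in Ω, g i x * g i x) + ∫ x in Ω, V x * v x * v x =
      ν * ∫ x in Ω, v x * v x := by
    have h1 : ∀ k, (∑ i, ∫ x in Ω, g i x * partialDeriv i (φ k) x) +
        ∫ x in Ω, V x * v x * φ k x = ν * ∫ x in Ω, v x * φ k x := by
      intro k
      have hi : ∀ i, Integrable (fun x => g i x * partialDeriv i (φ k) x) (volume.restrict Ω) :=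
        fun i => (hg i).integrable_mul (hφd i k)
      have hi2 : Integrable (fun x => V x * v x * φ k x) (volume.restrict Ω) :=
        hVv.integrable_mul (hφm k)
      rw [← hweak _ (hφ k), integral_add (integrable_finsetSum _ fun i _ => hi i) hi2,
        integral_finsetSum _ fun i _ => hi i]
    have h2 := (tendsto_finsetSum Finset.univ fun i _ =>
      tendsto_integral_mul_of_tendsto_eLpNorm (fun _ => hg i) (hφd i) (hg i) (hg i)
        (hconst (g i)) (hφg i)).add
      (tendsto_integral_mul_of_tendsto_eLpNorm (fun _ => hVv) hφm hVv hv (hconst _) hφv)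
    simp only [h1] at h2
    exact tendsto_nhds_unique h2 ((tendsto_integral_mul_of_tendsto_eLpNorm (fun _ => hv) hφm hv hv
      (hconst _) hφv).const_mul ν)
  have h3 := ((tendsto_finsetSum Finset.univ fun i _ =>
      tendsto_integral_mul_of_tendsto_eLpNorm (hφd i) (hφd i) (hg i) (hg i)
        (hφg i) (hφg i)).add
      (tendsto_integral_mul_of_tendsto_eLpNorm (fun k => h.memLp_potential_mul (hφm k)) hφm hVv hv
        (h.tendsto_potential_mul hφv) hφv)).sub
      ((tendsto_integral_mul_of_tendsto_eLpNorm hφm hφm hv hv hφv hφv).const_mul Λ)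
  rw [hlimit, ← sub_mul] at h3
  refine h3.congr fun k => ?_
  -- Jacobi's identity for `ψ = φ k / u`, for which `u ψ = φ k`.
  have h4 := h.energy_mul (h.isTestFunction_inv_mul (hφ k))
  simp only [h.mul_inv_mul (hφ k)] at h4
  linarith

theorem le_of_isDirichletEigenfunction (h : IsNodelessSolution Ω V Λ u) {ν : ℝ}
    {v : (Fin n → ℝ) → ℝ} (hv : IsDirichletEigenfunction Ω V ν v) : Λ ≤ ν := by
  obtain ⟨hne, g, ⟨hvm, hgm, φ, hφ, hφv, hφg⟩, hweak⟩ := hv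
  have h1 := h.tendsto_energy hvm hgm hweak hφ hφv hφg
  have h2 : 0 ≤ (ν - Λ) * ∫ x in Ω, v x * v x := ge_of_tendsto' h1 fun k =>
    Finset.sum_nonneg fun i _ => integral_nonneg fun x => mul_self_nonneg _
  have h3 : 0 < ∫ x in Ω, v x * v x := by
    refine lt_of_le_of_ne (integral_nonneg fun x => mul_self_nonneg _) fun h0 => hne ?_
    have := (integral_eq_zero_iff_of_nonneg (fun x => mul_self_nonneg (v x))
      (hvm.integrable_mul hvm)).1 h0.symm
    filter_upwards [this] with x hx
    simpa using hx
  linarith [nonneg_of_mul_nonneg_left h2 h3]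

/-- For `ν = Λ` the energies tend to zero: with `ψ k = φ k / u`, the fields `u ∇(ψ k)` tend to `0`
in `L²` while `u ψ k` tends to `v`. So `v / u` has zero weak gradient. -/
theorem eq_const_mul_of_isDirichletEigenfunction (h : IsNodelessSolution Ω V Λ u)
    {v : (Fin n → ℝ) → ℝ} (hv : IsDirichletEigenfunction Ω V Λ v) :
    ∃ C : ℝ, v =ᵐ[volume.restrict Ω] fun x => C * u x := by
  obtain ⟨-, g, ⟨hvm, hgm, φ, hφ, hφv, hφg⟩, hweak⟩ := hv
  have h1 := h.tendsto_energy hvm hgm hweak hφ hφv hφg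
  rw [sub_self, zero_mul] at h1
  set ψ : ℕ → (Fin n → ℝ) → ℝ := fun k x => (u x)⁻¹ * φ k x with hψdef
  have hψ : ∀ k, IsTestFunction Ω (ψ k) := fun k => h.isTestFunction_inv_mul (hφ k)
  have hcu := h.contDiff.continuous
  have hum : ∀ i k, MemLp (fun x => u x * partialDeriv i (ψ k) x) 2 (volume.restrict Ω) :=
    fun i k => h.memLp (hcu.mul (continuous_partialDeriv (hψ k).contDiff_one i))
  have hz : ∀ i, Tendsto (fun k => eLpNorm (fun x => u x * partialDeriv i (ψ k) x - 0) 2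
      (volume.restrict Ω)) atTop (𝓝 0) := by
    intro i
    simp only [sub_zero]
    refine tendsto_eLpNorm_two_of_tendsto_integral_sq (hum i) ?_
    refine tendsto_of_tendsto_of_tendsto_of_le_of_le tendsto_const_nhds h1
      (fun k => integral_nonneg fun x => sq_nonneg _) fun k => ?_
    simp only [pow_two]
    exact Finset.single_le_sum (f := fun i => ∫ x in Ω, (u x * partialDeriv i (ψ k) x) *
      (u x * partialDeriv i (ψ k) x)) (fun i _ => integral_nonneg fun x => mul_self_nonneg _)
      (Finset.mem_univ i)
  have hconst : ∀ f : (Fin n → ℝ) → ℝ,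
      Tendsto (fun _ : ℕ => eLpNorm (fun x => f x - f x) 2 (volume.restrict Ω)) atTop (𝓝 0) := by
    intro f
    simp only [sub_self, eLpNorm_zero']
    exact tendsto_const_nhds
  have hweak0 : ∀ ζ, IsTestFunction Ω ζ → ∀ i,
      ∫ x in Ω, (v x * (u x)⁻¹) * partialDeriv i ζ x = 0 := by
    intro ζ hζ i
    have hζu := h.isTestFunction_inv_mul hζ
    have hdu : MemLp (fun x => (u x)⁻¹ * partialDeriv i ζ x) 2 (volume.restrict Ω) := by
      have hd : IsTestFunction Ω (partialDeriv i ζ) := by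
        refine ⟨(hζ.1.fderiv_right (m := ∞) (by simp)).clm_apply contDiff_const,
          hasCompactSupport_partialDeriv hζ.2.1 i, ?_⟩
        refine (closure_minimal (fun x hx => ?_) (isClosed_tsupport ζ)).trans hζ.2.2
        by_contra hne
        exact hx (partialDeriv_eq_zero_of_notMem_tsupport hne i)
      exact (h.isTestFunction_inv_mul hd).memLp
    have l1 := tendsto_integral_mul_of_tendsto_eLpNorm (fun k => (hφ k).memLp) (fun _ => hdu) hvm
      hdu hφv (hconst _)
    have l2 := tendsto_integral_mul_of_tendsto_eLpNorm (hum i) (fun _ => hζu.memLp)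
      (MemLp.zero' (ε := ℝ)) hζu.memLp (hz i) (hconst _)
    simp only [zero_mul, integral_zero] at l2
    -- Integration by parts of `ψ k` against `ζ`, with a factor `u` moved so that both sides are
    -- `L²` pairings whose limits are known.
    have e1 : ∀ k, ∫ x in Ω, φ k x * ((u x)⁻¹ * partialDeriv i ζ x) =
        -∫ x in Ω, (u x * partialDeriv i (ψ k) x) * ((u x)⁻¹ * ζ x) := by
      intro k
      have e2 := integral_mul_partialDeriv (hψ k).contDiff_one hζ.contDiff_one hζ.2.1 i
      rw [setIntegral_eq_integral_of_forall_compl_eq_zero 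
          (fun x hx => by simp [hζ.partialDeriv_eq_zero hx]),
        setIntegral_eq_integral_of_forall_compl_eq_zero
          (fun x hx => by simp [hζ.eq_zero hx])]
      have e3 : ∀ x, φ k x * ((u x)⁻¹ * partialDeriv i ζ x) = ψ k x * partialDeriv i ζ x :=
        fun x => by simp only [hψdef]; ring
      have e4 : ∀ x, (u x * partialDeriv i (ψ k) x) * ((u x)⁻¹ * ζ x) =
          partialDeriv i (ψ k) x * ζ x := by
        intro x
        rw [mul_comm (u x), mul_assoc, h.mul_inv_mul hζ]
      simp only [e3, e4, e2]
    have l3 := tendsto_nhds_unique (l1.congr e1) (by simpa using l2.neg)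
    rw [← l3]
    refine integral_congr_ae (ae_of_all _ fun x => ?_)
    dsimp only
    ring
  obtain ⟨C, hC⟩ := ae_eq_const_of_weak_gradient_eq_zero h.isOpen h.bounded h.convex
    (w := fun x => v x * (u x)⁻¹) (fun K hK hKc => by
      have := h.isFiniteMeasure
      have hv0 : IntegrableOn v Ω := hvm.integrable (by norm_num)
      have hv1 : IntegrableOn v K := hv0.mono_set hK
      exact hv1.mul_continuousOn (h.smooth.continuousOn.mono hK |>.inv₀ fun x hx =>
        h.ne_zero x (hK hx)) hKc) hweak0
  refine ⟨C, ?_⟩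
  filter_upwards [hC, ae_restrict_mem h.isOpen.measurableSet] with x hx hxΩ
  rw [← hx, mul_assoc, inv_mul_cancel₀ (h.ne_zero x hxΩ), mul_one]

theorem isFirstDirichletEigenfunction (h : IsNodelessSolution Ω V Λ u) :
    IsFirstDirichletEigenfunction Ω V Λ u :=
  ⟨h.isDirichletEigenfunction, fun _ _ hv => h.le_of_isDirichletEigenfunction hv,
    fun _ hv => h.eq_const_mul_of_isDirichletEigenfunction hv⟩

end IsNodelessSolution

/-! ### Geometry of the simplex -/

section Simplex

variable {n : ℕ}

theorem isOpen_simplex : IsOpen (simplex n) := by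
  have : simplex n = (⋂ j, {x : Fin n → ℝ | x j ∈ Ioo (0:ℝ) 1}) ∩
      ⋂ i, ⋂ j, ⋂ (_ : i < j), {x : Fin n → ℝ | x i < x j} := by
    ext x
    simp only [simplex, StrictMono, mem_ofPred_eq, mem_inter_iff, mem_iInter]
  rw [this]
  exact (isOpen_iInter_of_finite fun j => isOpen_Ioo.preimage (continuous_apply j)).inter
    (isOpen_iInter_of_finite fun i => isOpen_iInter_of_finite fun j =>
      isOpen_iInter_of_finite fun _ => isOpen_lt (continuous_apply i) (continuous_apply j))

theorem convex_simplex : Convex ℝ (simplex n) := by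
  intro x hx y hy a b ha hb hab
  refine ⟨fun j => convex_Ioo 0 1 (hx.1 j) (hy.1 j) ha hb hab, fun i j hij => ?_⟩
  have h1 := hx.2 hij
  have h2 := hy.2 hij
  simp only [Pi.add_apply, Pi.smul_apply, smul_eq_mul]
  rcases ha.eq_or_lt with rfl | ha
  · simp only [zero_add] at hab
    simpa [hab] using h2
  · nlinarith [mul_lt_mul_of_pos_left h1 ha, mul_le_mul_of_nonneg_left h2.le hb]

theorem simplex_nonempty : (simplex n).Nonempty := by
  refine ⟨fun j => ((j : ℕ) + 1 : ℝ) / (n + 1), fun j => ⟨by positivity, ?_⟩, fun i j hij => ?_⟩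
  · rw [div_lt_one (by positivity)]
    have : ((j : ℕ) : ℝ) < n := by exact_mod_cast j.2
    linarith
  · dsimp only
    have : ((i : ℕ) : ℝ) < (j : ℕ) := by exact_mod_cast hij
    gcongr

theorem isBounded_simplex : Bornology.IsBounded (simplex n) :=
  (Metric.isBounded_Icc (0 : Fin n → ℝ) 1).subset fun _ hx =>
    ⟨fun j => (hx.1 j).1.le, fun j => (hx.1 j).2.le⟩

theorem closure_simplex_subset :
    closure (simplex n) ⊆ {x | (∀ j, x j ∈ Icc (0:ℝ) 1) ∧ Monotone x} := by
  refine closure_minimal (fun x hx => ⟨fun j => Ioo_subset_Icc_self (hx.1 j), hx.2.monotone⟩) ?_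
  refine IsClosed.inter (s₁ := {x : Fin n → ℝ | ∀ j, x j ∈ Icc (0:ℝ) 1}) ?_ isClosed_monotone
  simp only [Set.ofPred_forall]
  exact isClosed_iInter fun j => isClosed_Icc.preimage (continuous_apply j)

/-- On the boundary either two coordinates coincide, giving equal columns, or one is `0` or `1`,
giving a zero column. -/
theorem slater_eq_zero_of_frontier {h : ℕ → ℝ → ℝ} (h0 : ∀ j, h j 0 = 0) (h1 : ∀ j, h j 1 = 0)
    {x : Fin n → ℝ} (hx : x ∈ frontier (simplex n)) : slater h n x = 0 := by
  rw [isOpen_simplex.frontier_eq] at hx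
  obtain ⟨hI, hm⟩ := closure_simplex_subset hx.1
  by_cases hIoo : ∀ j, x j ∈ Ioo (0:ℝ) 1
  · have hni : ¬ Function.Injective x := fun hi => hx.2 ⟨hIoo, hm.strictMono_of_injective hi⟩
    simp only [Function.Injective, not_forall] at hni
    obtain ⟨i, j, hij, hne⟩ := hni
    exact Matrix.det_zero_of_column_eq hne fun k => by simp [hij]
  · push Not at hIoo
    obtain ⟨j, hj⟩ := hIoo
    refine Matrix.det_eq_zero_of_column_eq_zero j fun i => ?_
    rcases (hI j).1.eq_or_lt with h | h
    · simp [← h, h0]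
    · rcases (hI j).2.eq_or_lt with h' | h'
      · simp [h', h1]
      · exact absurd ⟨h, h'⟩ hj

end Simplex

/-! ### The Slater determinant as a sum of products -/

section Tensor

variable {n : ℕ}

/-- The function `x ↦ ∏ k, f k (x k)`. -/
def tensor (f : Fin n → ℝ → ℝ) (x : Fin n → ℝ) : ℝ := ∏ k, f k (x k)

theorem tensor_update (f : Fin n → ℝ → ℝ) (i : Fin n) (g : ℝ → ℝ) (x : Fin n → ℝ) :
    tensor (Function.update f i g) x = (∏ k ∈ Finset.univ.erase i, f k (x k)) * g (x i) := by
  rw [tensor, ← Finset.prod_erase_mul _ _ (Finset.mem_univ i)]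
  congr 1
  · exact Finset.prod_congr rfl fun k hk => by
      rw [Function.update_of_ne (Finset.ne_of_mem_erase hk)]
  · rw [Function.update_self]

theorem hasFDerivAt_tensor {f : Fin n → ℝ → ℝ} {x : Fin n → ℝ}
    (hf : ∀ k, DifferentiableAt ℝ (f k) (x k)) :
    HasFDerivAt (tensor f) (∑ k, (∏ j ∈ Finset.univ.erase k, f j (x j)) •
      (deriv (f k) (x k) • ContinuousLinearMap.proj (R := ℝ) (φ := fun _ : Fin n => ℝ) k)) x := by
  refine HasFDerivAt.finsetProd fun k _ => ?_
  exact (hf k).hasDerivAt.comp_hasFDerivAt x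
    (ContinuousLinearMap.proj (R := ℝ) (φ := fun _ : Fin n => ℝ) k).hasFDerivAt

theorem partialDeriv_tensor {f : Fin n → ℝ → ℝ} {x : Fin n → ℝ}
    (hf : ∀ k, DifferentiableAt ℝ (f k) (x k)) (i : Fin n) :
    partialDeriv i (tensor f) x = tensor (Function.update f i (deriv (f i))) x := by
  rw [partialDeriv, (hasFDerivAt_tensor hf).fderiv, tensor_update, sum_apply,
    Finset.sum_eq_single i]
  · simp
  · intro k _ hk
    simp [hk]
  · simp

theorem partialDeriv_sum_const_mul {ι : Type*} (s : Finset ι) (c : ι → ℝ)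
    (F : ι → (Fin n → ℝ) → ℝ) {x : Fin n → ℝ} (hF : ∀ a, DifferentiableAt ℝ (F a) x) (i : Fin n) :
    partialDeriv i (fun x => ∑ a ∈ s, c a * F a x) x = ∑ a ∈ s, c a * partialDeriv i (F a) x := by
  have h1 : HasFDerivAt (fun x => ∑ a ∈ s, c a * F a x) (∑ a ∈ s, c a • fderiv ℝ (F a) x) x :=
    HasFDerivAt.fun_sum fun a _ => (hF a).hasFDerivAt.const_mul (c a)
  simp [partialDeriv, h1.fderiv]

theorem slater_eq_sum_tensor (h : ℕ → ℝ → ℝ) (n : ℕ) :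
    slater h n = fun x => ∑ σ : Equiv.Perm (Fin n),
      ((Equiv.Perm.sign σ : ℤ) : ℝ) * tensor (fun k => h (σ k)) x := by
  funext x
  rw [slater, Matrix.det_apply']
  simp [tensor]

theorem contDiff_tensor {m : WithTop ℕ∞} {f : Fin n → ℝ → ℝ} (hf : ∀ k, ContDiff ℝ m (f k)) :
    ContDiff ℝ m (tensor f) :=
  contDiff_prod fun k _ => (hf k).comp (contDiff_apply ℝ ℝ k)

theorem contDiffOn_tensor {m : WithTop ℕ∞} {f : Fin n → ℝ → ℝ} {s : Set ℝ}
    {Ω : Set (Fin n → ℝ)} (hΩ : ∀ x ∈ Ω, ∀ k, x k ∈ s) (hf : ∀ k, ContDiffOn ℝ m (f k) s) :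
    ContDiffOn ℝ m (tensor f) Ω :=
  contDiffOn_prod fun k _ => (hf k).comp (contDiff_apply ℝ ℝ k).contDiffOn fun x hx => hΩ x hx k

end Tensor

/-- The Slater determinant is a solution without zeros in the open simplex. -/
theorem IsRegularEigenbasis.isNodelessSolution {q : ℝ → ℝ} {lam : ℕ → ℝ} {Y : ℕ → ℝ → ℝ}
    (hY : IsRegularEigenbasis q lam Y) (hq : ContDiffOn ℝ ∞ q (Ioo 0 1)) (n : ℕ) :
    IsNodelessSolution (simplex n) (potential q) (∑ j : Fin n, lam j) (slater Y n) where
  isOpen := isOpen_simplex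
  bounded := isBounded_simplex
  convex := convex_simplex
  nonempty := simplex_nonempty
  continuous_potential :=
    continuous_finsetSum _ fun j _ => hY.continuous.comp (continuous_apply j)
  contDiff := by
    rw [slater_eq_sum_tensor]
    exact ContDiff.sum fun σ _ => contDiff_const.mul
      (contDiff_tensor fun k => (hY.regular (σ k)).contDiff)
  smooth := by
    rw [slater_eq_sum_tensor]
    exact ContDiffOn.sum fun σ _ => contDiffOn_const.mul
      (contDiffOn_tensor (fun x hx => hx.1) fun k => (hY.regular (σ k)).contDiffOn_infty hq)
  ne_zero _ hx := hY.slater_ne_zero hx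
  frontier _ hx := slater_eq_zero_of_frontier hY.left hY.right hx
  pde x hx := by
    have hd : ∀ j y, DifferentiableAt ℝ (Y j) y := fun j y =>
      ((hY.regular j).hasDerivAt y).differentiableAt
    have hd' : ∀ j y, DifferentiableAt ℝ (deriv (Y j)) y := fun j y =>
      ((hY.regular j).hasDerivAt_deriv' y).differentiableAt
    have hup : ∀ (σ : Equiv.Perm (Fin n)) (i k : Fin n) (y : ℝ), DifferentiableAt ℝ
        (Function.update (fun k => Y (σ k)) i (deriv (Y (σ i))) k) y := by
      intro σ i k y
      rcases eq_or_ne k i with rfl | hk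
      · rw [Function.update_self]; exact hd' _ y
      · rw [Function.update_of_ne hk]; exact hd _ y
    have e1 : ∀ i, partialDeriv i (slater Y n) = fun x => ∑ σ : Equiv.Perm (Fin n),
        ((Equiv.Perm.sign σ : ℤ) : ℝ) *
          tensor (Function.update (fun k => Y (σ k)) i (deriv (Y (σ i)))) x := by
      intro i
      funext y
      rw [slater_eq_sum_tensor, partialDeriv_sum_const_mul _ _ _ fun σ : Equiv.Perm (Fin n) =>
        (hasFDerivAt_tensor fun k => hd (σ k) (y k)).differentiableAt]
      simp only [fun σ : Equiv.Perm (Fin n) => partialDeriv_tensor (f := fun k => Y (σ k))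
        (fun k => hd (σ k) (y k)) i]
    have e2 : ∀ i, partialDeriv i (partialDeriv i (slater Y n)) x = ∑ σ : Equiv.Perm (Fin n),
        ((Equiv.Perm.sign σ : ℤ) : ℝ) * ((q (x i) - lam (σ i)) * tensor (fun k => Y (σ k)) x) := by
      intro i
      rw [e1, partialDeriv_sum_const_mul _ _ _ fun σ =>
        (hasFDerivAt_tensor fun k => hup σ i k (x k)).differentiableAt]
      refine Finset.sum_congr rfl fun σ _ => ?_
      rw [partialDeriv_tensor fun k => hup σ i k (x k), Function.update_self,
        Function.update_idem, tensor_update,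
        (hY.regular (σ i)).ode (x i) (Ioo_subset_Icc_self (hx.1 i)), tensor,
        ← Finset.prod_erase_mul _ _ (Finset.mem_univ i)]
      ring
    simp only [e2]
    -- Each permutation only rearranges the eigenvalues, so every product in the expansion has the
    -- same total `Λ`.
    rw [Finset.sum_comm, slater_eq_sum_tensor, Finset.mul_sum]
    refine Finset.sum_congr rfl fun σ _ => ?_
    rw [← Finset.mul_sum, ← Finset.sum_mul, Finset.sum_sub_distrib,
      Equiv.sum_comp σ fun j : Fin n => lam j, potential]
    ring

/-! ### Return to the given data and choice of signs -/

section Congr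

variable {n : ℕ} {Ω : Set (Fin n → ℝ)} {V V' u u' : (Fin n → ℝ) → ℝ} {μ : ℝ}

theorem IsDirichletEigenfunction.congr (h : IsDirichletEigenfunction Ω V μ u) (hΩ : IsOpen Ω)
    (hV : EqOn V V' Ω) (hu : EqOn u u' Ω) : IsDirichletEigenfunction Ω V' μ u' := by
  obtain ⟨hne, g, ⟨hm, hg, φ, hφ, hφu, hφg⟩, hw⟩ := h
  have hae : u =ᵐ[volume.restrict Ω] u' :=
    (ae_restrict_iff' hΩ.measurableSet).2 (ae_of_all _ fun x hx => hu hx)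
  refine ⟨fun h0 => hne (hae.trans h0), g, ⟨(memLp_congr_ae hae).1 hm, hg, φ, hφ, ?_, hφg⟩,
    fun ψ hψ => ?_⟩
  · refine hφu.congr fun k => eLpNorm_congr_ae ?_
    filter_upwards [hae] with x hx
    rw [hx]
  · have e1 : ∫ x in Ω, ((∑ i, g i x * partialDeriv i ψ x) + V' x * u' x * ψ x) =
        ∫ x in Ω, ((∑ i, g i x * partialDeriv i ψ x) + V x * u x * ψ x) :=
      setIntegral_congr_fun hΩ.measurableSet fun x hx => by simp only [hV hx, hu hx]
    have e2 : ∫ x in Ω, u' x * ψ x = ∫ x in Ω, u x * ψ x :=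
      setIntegral_congr_fun hΩ.measurableSet fun x hx => by simp only [hu hx]
    rw [e1, e2, hw ψ hψ]

theorem IsFirstDirichletEigenfunction.congr (h : IsFirstDirichletEigenfunction Ω V μ u)
    (hΩ : IsOpen Ω) (hV : EqOn V V' Ω) (hu : EqOn u u' Ω) :
    IsFirstDirichletEigenfunction Ω V' μ u' := by
  refine ⟨h.1.congr hΩ hV hu, fun ν v hv => h.2.1 ν v (hv.congr hΩ hV.symm fun _ _ => rfl),
    fun v hv => ?_⟩
  obtain ⟨C, hC⟩ := h.2.2 v (hv.congr hΩ hV.symm fun _ _ => rfl)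
  refine ⟨C, ?_⟩
  filter_upwards [hC, ae_restrict_mem hΩ.measurableSet] with x hx hxΩ
  rw [hx, hu hxΩ]

end Congr

theorem slater_congr {h h' : ℕ → ℝ → ℝ} (hh : ∀ j, EqOn (h j) (h' j) (Icc 0 1)) {n : ℕ}
    {x : Fin n → ℝ} (hx : x ∈ simplex n) : slater h n x = slater h' n x := by
  unfold slater
  congr 1
  ext i j
  exact hh i (Ioo_subset_Icc_self (hx.1 j))

/-- The constant extension of a function on `[0,1]`. -/
noncomputable def clamp (q : ℝ → ℝ) (t : ℝ) : ℝ := q (projIcc 0 1 zero_le_one t : Icc (0:ℝ) 1)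

theorem clamp_eqOn (q : ℝ → ℝ) : EqOn q (clamp q) (Icc 0 1) := fun t ht => by
  rw [clamp, projIcc_of_mem zero_le_one ht]

theorem continuous_clamp {q : ℝ → ℝ} (hq : ContinuousOn q (Icc 0 1)) : Continuous (clamp q) :=
  hq.comp_continuous (continuous_subtype_val.comp continuous_projIcc)
    fun t => (projIcc 0 1 zero_le_one t).2

theorem exists_abs_clamp_le {q : ℝ → ℝ} (hq : ContinuousOn q (Icc 0 1)) :
    ∃ B, ∀ t, |clamp q t| ≤ B := by
  obtain ⟨B, hB⟩ := isCompact_Icc.exists_bound_of_continuousOn hq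
  exact ⟨B, fun t => hB _ (projIcc 0 1 zero_le_one t).2⟩

/-- The Prüfer argument needs a bounded continuous potential on the line. The eigenvalue problem
sees only `[0,1]`, so `q` may be replaced by its constant extension. -/
theorem IsSturmEigenpairs.exists_regularEigenbasis {q : ℝ → ℝ} {lam : ℕ → ℝ} {h : ℕ → ℝ → ℝ}
    (hh : IsSturmEigenpairs q lam h) (hq : ContinuousOn q (Icc 0 1)) :
    ∃ Y : ℕ → ℝ → ℝ, IsRegularEigenbasis (clamp q) lam Y ∧ ∀ j, EqOn (Y j) (h j) (Icc 0 1) := by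
  have hc := continuous_clamp hq
  obtain ⟨B, hB⟩ := exists_abs_clamp_le hq
  have hh' : IsSturmEigenpairs (clamp q) lam h :=
    ⟨hh.strictMono, fun j => (hh.eigen j).congr_potential (clamp_eqOn q),
      fun μ y hy => hh.exhaust μ y (hy.congr_potential (clamp_eqOn q).symm), hh.orthonormal⟩
  choose Y hY hYe using fun j => (hh'.eigen j).exists_extension hc.continuousOn
  refine ⟨Y, ⟨hh.strictMono, hc, hY, fun j => ?_, fun j => ?_, fun j => ?_, fun j N hZ =>
    hh'.zeros_le hc hB (hZ.congr (hYe j))⟩, hYe⟩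
  · rw [hYe j (by simp), (hh.eigen j).left]
  · rw [hYe j (by simp), (hh.eigen j).right]
  · obtain ⟨x, hx, hne⟩ := (hh.eigen j).nontrivial
    exact ⟨x, Ioo_subset_Icc_self hx, by rwa [hYe j (Ioo_subset_Icc_self hx)]⟩

/-- A nonvanishing continuous function on a convex set has a constant sign. -/
theorem exists_sign_of_ne_zero {n : ℕ} {Ω : Set (Fin n → ℝ)} (hΩ : Convex ℝ Ω)
    {f : (Fin n → ℝ) → ℝ} (hf : ContinuousOn f Ω) (hne : ∀ x ∈ Ω, f x ≠ 0) :
    ∃ s : ℝ, (s = 1 ∨ s = -1) ∧ ∀ x ∈ Ω, 0 < s * f x := by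
  by_cases hpos : ∀ x ∈ Ω, 0 < f x
  · exact ⟨1, Or.inl rfl, fun x hx => by simpa using hpos x hx⟩
  push Not at hpos
  obtain ⟨a, ha, hfa⟩ := hpos
  refine ⟨-1, Or.inr rfl, fun x hx => ?_⟩
  by_contra hcon
  obtain ⟨c, hc, hc0⟩ := hΩ.isPreconnected.intermediate_value ha hx hf
    (show (0:ℝ) ∈ Icc (f a) (f x) from ⟨hfa, by linarith⟩)
  exact hne c hc hc0

theorem slater_const_mul (ε : ℕ → ℝ) (h : ℕ → ℝ → ℝ) (k : ℕ) (x : Fin k → ℝ) :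
    slater (fun j t => ε j * h j t) k x = (∏ j ∈ Finset.range k, ε j) * slater h k x := by
  rw [Finset.prod_range, slater, slater, ← Matrix.det_mul_column]
  rfl

/-- If all Slater determinants have constant sign, the signs of the functions can be normalised. -/
theorem exists_signs_slater_pos {h : ℕ → ℝ → ℝ}
    (hs : ∀ k, ∃ s : ℝ, (s = 1 ∨ s = -1) ∧ ∀ x ∈ simplex k, 0 < s * slater h k x) :
    ∃ ε : ℕ → ℝ, (∀ j, ε j = 1 ∨ ε j = -1) ∧
      ∀ k, ∀ x ∈ simplex k, 0 < slater (fun j t => ε j * h j t) k x := by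
  choose s hs1 hs2 using hs
  have hsq : ∀ k, s k * s k = 1 := fun k => by rcases hs1 k with h | h <;> rw [h] <;> norm_num
  -- The empty determinant is `1`; this starts the telescoping product.
  have hs0 : s 0 = 1 := by
    obtain ⟨x, hx⟩ := simplex_nonempty (n := 0)
    have := hs2 0 x hx
    rcases hs1 0 with h0 | h0
    · exact h0
    · rw [h0] at this
      norm_num [slater] at this
  -- The product of these signs over `j < k` telescopes to `s 0 * s k = s k`, which corrects the
  -- `k`-th determinant for all `k` at once.
  refine ⟨fun j => s j * s (j + 1), fun j => ?_, fun k x hx => ?_⟩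
  · rcases hs1 j with h | h <;> rcases hs1 (j + 1) with h' | h' <;> simp [h, h']
  · have hprod : ∏ j ∈ Finset.range k, s j * s (j + 1) = s k := by
      clear hx x
      induction k with
      | zero => simp [hs0]
      | succ k ih => rw [Finset.prod_range_succ, ih, ← mul_assoc, hsq, one_mul]
    rw [slater_const_mul, hprod]
    exact hs2 k x hx

theorem linearIndependent_of_slater_ne_zero {h : ℕ → ℝ → ℝ} {n : ℕ} {c : Fin n → ℝ}
    (hc : slater h n c ≠ 0) : LinearIndependent ℝ fun j : Fin n => fun i : Fin n => h i (c j) :=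
  Matrix.linearIndependent_cols_of_det_ne_zero hc

end SturmGelfand

theorem lemma6p2 (q : ℝ → ℝ)
    (hq : ∃ U : Set ℝ, IsOpen U ∧ Set.Icc (0 : ℝ) 1 ⊆ U ∧ ContDiffOn ℝ ∞ q U)
    (lam : ℕ → ℝ) (h : ℕ → ℝ → ℝ) (hh : SturmGelfand.IsSturmEigenpairs q lam h)
    (n : ℕ) (hn : 1 ≤ n) :
    SturmGelfand.IsFirstDirichletEigenfunction (SturmGelfand.simplex n)
        (SturmGelfand.potential q) (∑ j : Fin n, lam j) (SturmGelfand.slater h n) ∧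
      (∀ x ∈ SturmGelfand.simplex n, SturmGelfand.slater h n x ≠ 0) ∧
      (∃ ε : ℕ → ℝ, (∀ j, ε j = 1 ∨ ε j = -1) ∧
        ∀ k : ℕ, 1 ≤ k → k ≤ n → ∀ x ∈ SturmGelfand.simplex k,
          0 < SturmGelfand.slater (fun j t => ε j * h j t) k x) ∧
      ∀ c : Fin n → ℝ, (∀ j, c j ∈ Set.Ioo (0 : ℝ) 1) → StrictMono c →
        LinearIndependent ℝ (fun j : Fin n => (fun i : Fin n => h i (c j))) := by
  open SturmGelfand in
  obtain ⟨U, -, hU, hqU⟩ := hq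
  have hqc : ContinuousOn q (Icc 0 1) := hqU.continuousOn.mono hU
  obtain ⟨Y, hY, hYe⟩ := hh.exists_regularEigenbasis hqc
  have hclamp : ContDiffOn ℝ ∞ (clamp q) (Ioo 0 1) :=
    (hqU.mono (Ioo_subset_Icc_self.trans hU)).congr fun x hx =>
      (clamp_eqOn q (Ioo_subset_Icc_self hx)).symm
  have hS : ∀ k, EqOn (slater Y k) (slater h k) (simplex k) := fun k x hx => slater_congr hYe hx
  have hne : ∀ k, ∀ x ∈ simplex k, slater h k x ≠ 0 := fun k x hx => by
    rw [← hS k hx]; exact hY.slater_ne_zero hx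
  refine ⟨?_, hne n, ?_, fun c hc hcm => linearIndependent_of_slater_ne_zero (hne n c ⟨hc, hcm⟩)⟩
  · refine (hY.isNodelessSolution hclamp n).isFirstDirichletEigenfunction.congr isOpen_simplex
      (fun x hx => ?_) (hS n)
    exact Finset.sum_congr rfl fun j _ => (clamp_eqOn q (Ioo_subset_Icc_self (hx.1 j))).symm
  · obtain ⟨ε, hε, hpos⟩ := exists_signs_slater_pos (h := h) fun k =>
      exists_sign_of_ne_zero convex_simplex
        ((hY.isNodelessSolution hclamp k).contDiff.continuous.continuousOn.congr (hS k).symm)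
        (hne k)
    exact ⟨ε, hε, fun k _ _ => hpos k⟩
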